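/- Let $(M,g)$ be a connected smooth Riemannian manifold of dimension six with Levi-Civita connection $\nabla$, and let $J$ be a smooth almost complex structure on $M$ that is orthogonal with respect to $g$, i.e. $J^2=-\mathrm{id}$ and $g(JX,JY)=g(X,Y)$. Write $\sigma(X,Y)=g(JX,Y)$ and $(\nabla_XJ)Y=\nabla_X(JY)-J\nabla_XY$. Suppose that $(M,g,J)$ is nearly Kähler, i.e. $(\nabla_XJ)X=0$ for every smooth vector field $X$ on $M$, and strict, i.e. $\nabla J$ does not vanish identically. With the curvature convention $R(X,Y)Z=\nabla_X\nabla_YZ-\nabla_Y\nabla_XZ-\nabla_{[X,Y]}Z$, let $\mathrm{Ric}_g(X,Y)=\sum_{i=1}^{6}g(R(X,E_i)E_i,Y)$ for an orthonormal frame $E_1,\dots,E_6$, and let the scalar curvature be the trace of $\mathrm{Ric}_g$ with respect to $g$. Then $g$ is an Einstein metric (that is, $\mathrm{Ric}_g=c\,g$ for some constant $c\in\mathbb{R}$) with positive scalar curvature. More precisely, there is exactly one constant $\mu>0$ such that $$\|(\nabla_XJ)Y\|^2=\mu^2\bigl(\|X\|^2\|Y\|^2-g(X,Y)^2-\sigma(X,Y)^2\bigr)$$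 for all tangent vectors $X,Y$ at the same point of $M$, and for this constant $\mathrm{Ric}_g=5\mu^2 g$. -/

import Mathlib

open Bundle FiberBundle VectorField Module
open scoped Manifold ContDiff

set_option linter.unusedSectionVars false

noncomputable section RiemannianGeometry

/- `M` is a smooth manifold whose tangent bundle carries a smooth Riemannian metric `g`,
written `inner ℝ v w` for `v w : TangentSpace I x`. -/
variable {E : Type*} [NormedAddCommGroup E] [NormedSpace ℝ E] [FiniteDimensional ℝ E]
  {H : Type*} [TopologicalSpace H] (I : ModelWithCorners ℝ E H)
  {M : Type*} [TopologicalSpace M] [ChartedSpace H M] [IsManifold I ∞ M]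
  [RiemannianBundle (fun x : M => TangentSpace I x)]
  [IsContMDiffRiemannianBundle I ∞ E (fun x : M => TangentSpace I x)]

instance tangentSpaceFiniteDimensional (x : M) : FiniteDimensional ℝ (TangentSpace I x) :=
  inferInstanceAs (FiniteDimensional ℝ E)

/-! ### The Levi-Civita connection -/

/-- The right-hand side of the Koszul formula for `2 g(∇_X Y, Z)` at the point `x`. -/
def koszul (Y X Z : Π x : M, TangentSpace I x) (x : M) : ℝ :=
  d% (fun y => inner ℝ (Y y) (Z y)) x (X x)
    + d% (fun y => inner ℝ (X y) (Z y)) x (Y x)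
    - d% (fun y => inner ℝ (X y) (Y y)) x (Z x)
    + inner ℝ (mlieBracket I X Y x) (Z x)
    - inner ℝ (mlieBracket I X Z x) (Y x)
    - inner ℝ (mlieBracket I Y Z x) (X x)

variable {I}

lemma mdifferentiableAt_inner {x : M} {X Y : Π x : M, TangentSpace I x}
    (hX : MDiffAt (T% X) x) (hY : MDiffAt (T% Y) x) :
    MDiffAt (fun y => inner ℝ (X y) (Y y)) x := by
  have : IsContMDiffRiemannianBundle I 1 E (fun x : M => TangentSpace I x) := inferInstance
  exact MDifferentiableAt.inner_bundle (IB := I) (F := E) (E := fun x : M => TangentSpace I x)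
    (b := id) (v := X) (w := Y) hX hY

lemma koszul_tensorial_left {x : M} {Y Z : Π x : M, TangentSpace I x}
    (hY : MDiffAt (T% Y) x) (hZ : MDiffAt (T% Z) x) :
    TensorialAt I E (fun X => koszul I Y X Z x) x where
  smul {f X} hf hX := by
    have h1 : d% (fun y => inner ℝ ((f • X) y) (Z y)) x
        = f x • d% (fun y => inner ℝ (X y) (Z y)) x + inner ℝ (X x) (Z x) • d% f x := by
      simp only [Pi.smul_apply', inner_smul_left]
      exact mvfderiv_fun_mul hf (mdifferentiableAt_inner hX hZ)
    have h2 : d% (fun y => inner ℝ ((f • X) y) (Y y)) x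
        = f x • d% (fun y => inner ℝ (X y) (Y y)) x + inner ℝ (X x) (Y x) • d% f x := by
      simp only [Pi.smul_apply', inner_smul_left]
      exact mvfderiv_fun_mul hf (mdifferentiableAt_inner hX hY)
    simp only [koszul, h1, h2, mlieBracket_smul_left hf hX]
    simp [inner_add_left, inner_smul_left, inner_smul_right, real_inner_comm]
    ring
  add {X X'} hX hX' := by
    have h1 : d% (fun y => inner ℝ ((X + X') y) (Z y)) x
        = d% (fun y => inner ℝ (X y) (Z y)) x + d% (fun y => inner ℝ (X' y) (Z y)) x := by
      simp only [Pi.add_apply, inner_add_left]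
      exact mvfderiv_fun_add (mdifferentiableAt_inner hX hZ) (mdifferentiableAt_inner hX' hZ)
    have h2 : d% (fun y => inner ℝ ((X + X') y) (Y y)) x
        = d% (fun y => inner ℝ (X y) (Y y)) x + d% (fun y => inner ℝ (X' y) (Y y)) x := by
      simp only [Pi.add_apply, inner_add_left]
      exact mvfderiv_fun_add (mdifferentiableAt_inner hX hY) (mdifferentiableAt_inner hX' hY)
    simp only [koszul, h1, h2, mlieBracket_add_left hX hX']
    simp [inner_add_left, inner_add_right]
    ring

lemma koszul_tensorial_right {x : M} {Y X : Π x : M, TangentSpace I x}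
    (hY : MDiffAt (T% Y) x) (hX : MDiffAt (T% X) x) :
    TensorialAt I E (fun Z => koszul I Y X Z x) x where
  smul {f Z} hf hZ := by
    have h1 : d% (fun y => inner ℝ (Y y) ((f • Z) y)) x
        = f x • d% (fun y => inner ℝ (Y y) (Z y)) x + inner ℝ (Y x) (Z x) • d% f x := by
      simp only [Pi.smul_apply', inner_smul_right]
      exact mvfderiv_fun_mul hf (mdifferentiableAt_inner hY hZ)
    have h2 : d% (fun y => inner ℝ (X y) ((f • Z) y)) x
        = f x • d% (fun y => inner ℝ (X y) (Z y)) x + inner ℝ (X x) (Z x) • d% f x := by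
      simp only [Pi.smul_apply', inner_smul_right]
      exact mvfderiv_fun_mul hf (mdifferentiableAt_inner hX hZ)
    simp only [koszul, h1, h2, mlieBracket_smul_right hf hZ]
    simp [inner_add_left, inner_smul_left, inner_smul_right, real_inner_comm]
    ring
  add {Z Z'} hZ hZ' := by
    have h1 : d% (fun y => inner ℝ (Y y) ((Z + Z') y)) x
        = d% (fun y => inner ℝ (Y y) (Z y)) x + d% (fun y => inner ℝ (Y y) (Z' y)) x := by
      simp only [Pi.add_apply, inner_add_right]
      exact mvfderiv_fun_add (mdifferentiableAt_inner hY hZ) (mdifferentiableAt_inner hY hZ')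
    have h2 : d% (fun y => inner ℝ (X y) ((Z + Z') y)) x
        = d% (fun y => inner ℝ (X y) (Z y)) x + d% (fun y => inner ℝ (X y) (Z' y)) x := by
      simp only [Pi.add_apply, inner_add_right]
      exact mvfderiv_fun_add (mdifferentiableAt_inner hX hZ) (mdifferentiableAt_inner hX hZ')
    simp only [koszul, h1, h2, mlieBracket_add_right hZ hZ']
    simp [inner_add_left, inner_add_right]
    ring

/-- The bilinear form `(u, w) ↦ 2 g(∇_u Y, w)` on the tangent space at `x`. -/
def koszulForm {x : M} (Y : Π x : M, TangentSpace I x) (hY : MDiffAt (T% Y) x) :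
    TangentSpace I x →L[ℝ] TangentSpace I x →L[ℝ] ℝ :=
  TensorialAt.mkHom₂ (fun X Z => koszul I Y X Z x) x
    (fun _ hZ => koszul_tensorial_left hY hZ) (fun _ hX => koszul_tensorial_right hY hX)

lemma koszulForm_apply {x : M} {Y X Z : Π x : M, TangentSpace I x} (hY : MDiffAt (T% Y) x)
    (hX : MDiffAt (T% X) x) (hZ : MDiffAt (T% Z) x) :
    koszulForm Y hY (X x) (Z x) = koszul I Y X Z x :=
  TensorialAt.mkHom₂_apply _ _ hX hZ

open Classical in
/-- `u ↦ ∇_u Y` at `x`, where `g(∇_u Y, w)` is half the Koszul form. -/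
def leviCivitaFun (Y : Π x : M, TangentSpace I x) (x : M) :
    TangentSpace I x →L[ℝ] TangentSpace I x :=
  if hY : MDiffAt (T% Y) x then
    (1 / 2 : ℝ) • ∑ i, ((koszulForm Y hY).flip (stdOrthonormalBasis ℝ (TangentSpace I x) i)).smulRight
      (stdOrthonormalBasis ℝ (TangentSpace I x) i)
  else 0

lemma inner_leviCivitaFun {x : M} {Y X Z : Π x : M, TangentSpace I x} (hY : MDiffAt (T% Y) x)
    (hX : MDiffAt (T% X) x) (hZ : MDiffAt (T% Z) x) :
    inner ℝ (leviCivitaFun Y x (X x)) (Z x) = (1 / 2 : ℝ) * koszul I Y X Z x := by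
  rw [← koszulForm_apply hY hX hZ]
  have h : Z x = ∑ i, inner ℝ (stdOrthonormalBasis ℝ (TangentSpace I x) i) (Z x) •
      stdOrthonormalBasis ℝ (TangentSpace I x) i :=
    ((stdOrthonormalBasis ℝ (TangentSpace I x)).sum_repr' (Z x)).symm
  conv_rhs => rw [h]
  simp only [leviCivitaFun, dif_pos hY, map_sum, map_smul]
  simp [inner_smul_left, sum_inner, mul_comm]

/-- Two tangent maps agree if all their products with values of differentiable fields agree. -/
lemma tangentMap_ext {x : M} {A B : TangentSpace I x →L[ℝ] TangentSpace I x}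
    (h : ∀ X Z : Π x : M, TangentSpace I x, MDiffAt (T% X) x → MDiffAt (T% Z) x →
      (inner ℝ (A (X x)) (Z x) : ℝ) = inner ℝ (B (X x)) (Z x)) : A = B := by
  ext v
  refine ext_inner_right ℝ fun w => ?_
  have := h (extend E v) (extend E w) (mdifferentiableAt_extend I E v)
    (mdifferentiableAt_extend I E w)
  simpa using this

variable (I M) in
/-- The Levi-Civita connection of the Riemannian metric, `leviCivita I M Y x v = (∇_v Y)(x)`. -/
def leviCivita : CovariantDerivative I E (fun x : M => TangentSpace I x) where
  toFun := leviCivitaFun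
  isCovariantDerivativeOnUniv :=
    { add := by
        intro Y Y' x hY hY' _
        refine tangentMap_ext fun X Z hX hZ => ?_
        have hYY : MDiffAt (T% (Y + Y')) x := mdifferentiableAt_add_section hY hY'
        rw [inner_leviCivitaFun hYY hX hZ, add_apply, inner_add_left,
          inner_leviCivitaFun hY hX hZ, inner_leviCivitaFun hY' hX hZ]
        have h1 : d% (fun y => inner ℝ ((Y + Y') y) (Z y)) x
            = d% (fun y => inner ℝ (Y y) (Z y)) x + d% (fun y => inner ℝ (Y' y) (Z y)) x := by
          simp only [Pi.add_apply, inner_add_left]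
          exact mvfderiv_fun_add (mdifferentiableAt_inner hY hZ) (mdifferentiableAt_inner hY' hZ)
        have h2 : d% (fun y => inner ℝ (X y) ((Y + Y') y)) x
            = d% (fun y => inner ℝ (X y) (Y y)) x + d% (fun y => inner ℝ (X y) (Y' y)) x := by
          simp only [Pi.add_apply, inner_add_right]
          exact mvfderiv_fun_add (mdifferentiableAt_inner hX hY) (mdifferentiableAt_inner hX hY')
        simp only [koszul, h1, h2, mlieBracket_add_right hY hY', mlieBracket_add_left hY hY']
        simp [inner_add_left, inner_add_right]
        ring
      leibniz := by
        intro Y f x hY hf _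
        refine tangentMap_ext fun X Z hX hZ => ?_
        have hfY : MDiffAt (T% (f • Y)) x := hf.smul_section hY
        rw [inner_leviCivitaFun hfY hX hZ, add_apply, inner_add_left,
          smul_apply, inner_smul_left, inner_leviCivitaFun hY hX hZ]
        have h1 : d% (fun y => inner ℝ ((f • Y) y) (Z y)) x
            = f x • d% (fun y => inner ℝ (Y y) (Z y)) x + inner ℝ (Y x) (Z x) • d% f x := by
          simp only [Pi.smul_apply', inner_smul_left]
          exact mvfderiv_fun_mul hf (mdifferentiableAt_inner hY hZ)
        have h2 : d% (fun y => inner ℝ (X y) ((f • Y) y)) x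
            = f x • d% (fun y => inner ℝ (X y) (Y y)) x + inner ℝ (X x) (Y x) • d% f x := by
          simp only [Pi.smul_apply', inner_smul_right]
          exact mvfderiv_fun_mul hf (mdifferentiableAt_inner hX hY)
        simp only [koszul, h1, h2, mlieBracket_smul_right hf hY, mlieBracket_smul_left hf hY]
        simp [inner_add_left, inner_smul_left, inner_smul_right, real_inner_comm]
        ring }

/-- The Levi-Civita connection is compatible with the metric. -/
lemma leviCivita_metric {x : M} {X Y Z : Π x : M, TangentSpace I x} (hX : MDiffAt (T% X) x)
    (hY : MDiffAt (T% Y) x) (hZ : MDiffAt (T% Z) x) :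
    d% (fun y => inner ℝ (Y y) (Z y)) x (X x)
      = inner ℝ (leviCivita I M Y x (X x)) (Z x) + inner ℝ (Y x) (leviCivita I M Z x (X x)) := by
  have h1 : inner ℝ (leviCivita I M Y x (X x)) (Z x) = (1 / 2 : ℝ) * koszul I Y X Z x :=
    inner_leviCivitaFun hY hX hZ
  have h2 : inner ℝ (leviCivita I M Z x (X x)) (Y x) = (1 / 2 : ℝ) * koszul I Z X Y x :=
    inner_leviCivitaFun hZ hX hY
  rw [real_inner_comm (leviCivita I M Z x (X x)) (Y x), h1, h2]
  simp only [koszul]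
  rw [mlieBracket_swap_apply (V := Z) (W := Y)]
  have hc : (fun y => (inner ℝ (Z y) (Y y) : ℝ)) = fun y => inner ℝ (Y y) (Z y) :=
    funext fun y => real_inner_comm _ _
  rw [hc, inner_neg_left]
  ring

/-- The Levi-Civita connection is torsion-free. -/
lemma leviCivita_torsionFree {x : M} {X Y : Π x : M, TangentSpace I x} (hX : MDiffAt (T% X) x)
    (hY : MDiffAt (T% Y) x) :
    leviCivita I M Y x (X x) - leviCivita I M X x (Y x) = mlieBracket I X Y x := by
  refine ext_inner_right ℝ fun w => ?_
  have hw : MDiffAt (T% (extend E w)) x := mdifferentiableAt_extend I E w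
  have h1 : inner ℝ (leviCivita I M Y x (X x)) (extend E w x)
      = (1 / 2 : ℝ) * koszul I Y X (extend E w) x := inner_leviCivitaFun hY hX hw
  have h2 : inner ℝ (leviCivita I M X x (Y x)) (extend E w x)
      = (1 / 2 : ℝ) * koszul I X Y (extend E w) x := inner_leviCivitaFun hX hY hw
  rw [extend_apply_self] at h1 h2
  rw [inner_sub_left, h1, h2]
  simp only [koszul]
  rw [mlieBracket_swap_apply (V := Y) (W := X)]
  have hc : (fun y => (inner ℝ (Y y) (X y) : ℝ)) = fun y => inner ℝ (X y) (Y y) :=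
    funext fun y => real_inner_comm _ _
  rw [hc, extend_apply_self, inner_neg_left]
  ring

/-! ### Curvature -/

variable (I) in
/-- The field `R(X, Y)Z = ∇_X ∇_Y Z - ∇_Y ∇_X Z - ∇_[X,Y] Z`. -/
def curvatureField (X Y Z : Π x : M, TangentSpace I x) (x : M) : TangentSpace I x :=
  leviCivita I M (fun y => leviCivita I M Z y (Y y)) x (X x)
    - leviCivita I M (fun y => leviCivita I M Z y (X y)) x (Y x)
    - leviCivita I M Z x (mlieBracket I X Y x)

variable (I) in
/-- The curvature tensor `R(u, v)w` at `x`: the value at `x` of `R(X, Y)Z` for vector fields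
`X`, `Y`, `Z`, smooth near `x`, with `X x = u`, `Y x = v`, `Z x = w`. -/
def curvature (x : M) (u v w : TangentSpace I x) : TangentSpace I x :=
  curvatureField I (extend E u) (extend E v) (extend E w) x

variable (I) in
/-- The Ricci tensor `Ric(u, v) = ∑ᵢ g(R(u, eᵢ)eᵢ, v)`, for an orthonormal basis `e`. -/
def ricci (x : M) (u v : TangentSpace I x) : ℝ :=
  ∑ i, inner ℝ (curvature I x u (stdOrthonormalBasis ℝ (TangentSpace I x) i)
    (stdOrthonormalBasis ℝ (TangentSpace I x) i)) v

variable (I) in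
/-- The scalar curvature, the trace of the Ricci tensor. -/
def scalarCurvature (x : M) : ℝ :=
  ∑ i, ricci I x (stdOrthonormalBasis ℝ (TangentSpace I x) i)
    (stdOrthonormalBasis ℝ (TangentSpace I x) i)

variable (I M) in
/-- The metric is Einstein: `Ric = c g` for a constant `c`. -/
def IsEinstein : Prop :=
  ∃ c : ℝ, ∀ (x : M) (u v : TangentSpace I x), ricci I x u v = c * inner ℝ u v

/-! ### Almost Hermitian and nearly Kähler structures -/

variable (I M) in
/-- A smooth almost complex structure on `M`, orthogonal for the Riemannian metric. -/
structure OrthogonalAlmostComplexStructure where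
  /-- the endomorphism `J` of the tangent space at `x` -/
  J : ∀ x : M, TangentSpace I x →L[ℝ] TangentSpace I x
  contMDiff_J : ContMDiff I (I.prod 𝓘(ℝ, E →L[ℝ] E)) ∞
    (fun x => TotalSpace.mk' (E →L[ℝ] E)
      (E := fun x : M => TangentSpace I x →L[ℝ] TangentSpace I x) x (J x))
  J_J : ∀ (x : M) (v : TangentSpace I x), J x (J x v) = -v
  inner_J_J : ∀ (x : M) (v w : TangentSpace I x),
    (inner ℝ (J x v) (J x w) : ℝ) = inner ℝ v w

namespace OrthogonalAlmostComplexStructure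

variable (S : OrthogonalAlmostComplexStructure I M)

/-- The fundamental two-form `σ(v, w) = g(Jv, w)`. -/
def sigma (x : M) (v w : TangentSpace I x) : ℝ := inner ℝ (S.J x v) w

lemma mdifferentiableAt_J {x : M} {Y : Π x : M, TangentSpace I x} (hY : MDiffAt (T% Y) x) :
    MDiffAt (T% (fun y => S.J y (Y y))) x := by
  have h : MDifferentiableAt I (I.prod 𝓘(ℝ, E →L[ℝ] E))
      (fun x => TotalSpace.mk' (E →L[ℝ] E)
        (E := fun x : M => TangentSpace I x →L[ℝ] TangentSpace I x) x (S.J x)) x :=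
    S.contMDiff_J.mdifferentiable (by simp) x
  exact MDifferentiableAt.clm_bundle_apply (b := id) h hY

lemma nablaJ_tensorial (x : M) :
    TensorialAt I E (fun Y : Π x : M, TangentSpace I x =>
      leviCivita I M (fun y => S.J y (Y y)) x - S.J x ∘L leviCivita I M Y x) x where
  smul {f Y} hf hY := by
    have h1 := (leviCivita I M).isCovariantDerivativeOn.leibniz hY hf (x := x)
    have h2 := (leviCivita I M).isCovariantDerivativeOn.leibniz (S.mdifferentiableAt_J hY) hf
      (x := x)
    have h3 : (fun y => S.J y ((f • Y) y)) = f • fun y => S.J y (Y y) := by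
      ext y; simp
    rw [h3, h1, h2]
    ext v
    simp
    module
  add {Y Y'} hY hY' := by
    have h1 := (leviCivita I M).isCovariantDerivativeOn.add hY hY' (x := x)
    have h2 := (leviCivita I M).isCovariantDerivativeOn.add (S.mdifferentiableAt_J hY)
      (S.mdifferentiableAt_J hY') (x := x)
    have h3 : (fun y => S.J y ((Y + Y') y)) = (fun y => S.J y (Y y)) + fun y => S.J y (Y' y) := by
      ext y; simp
    rw [h3, h1, h2]
    ext v
    simp
    module

/-- The tensor `∇J` at `x`, as `S.nablaJ x v w = (∇_v J) w`. -/
def nablaJ (x : M) (v : TangentSpace I x) : TangentSpace I x →L[ℝ] TangentSpace I x :=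
  (TensorialAt.mkHom _ x (S.nablaJ_tensorial x)).flip v

/-- `(∇_X J)Y = ∇_X(JY) - J(∇_X Y)`. -/
lemma nablaJ_apply {x : M} (X : Π x : M, TangentSpace I x) {Y : Π x : M, TangentSpace I x}
    (hY : MDiffAt (T% Y) x) :
    S.nablaJ x (X x) (Y x)
      = leviCivita I M (fun y => S.J y (Y y)) x (X x) - S.J x (leviCivita I M Y x (X x)) := by
  have h := TensorialAt.mkHom_apply (S.nablaJ_tensorial x) hY
  simp only [nablaJ, ContinuousLinearMap.flip_apply, h]
  rfl

/-- The structure is nearly Kähler: `(∇_X J)X = 0` for every smooth vector field `X`. -/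
def IsNearlyKahler : Prop :=
  ∀ X : Π x : M, TangentSpace I x, ContMDiff I I.tangent ∞ (T% X) →
    ∀ x, S.nablaJ x (X x) (X x) = 0

/-- The structure is strict, that is, not Kähler: `∇J` does not vanish identically. -/
def IsStrict : Prop :=
  ∃ (x : M) (v w : TangentSpace I x), S.nablaJ x v w ≠ 0

/-- `‖(∇_v J)w‖² = μ² (‖v‖² ‖w‖² - g(v, w)² - σ(v, w)²)` for all tangent vectors `v`, `w`. -/
def HasConstantType (μ : ℝ) : Prop :=
  ∀ (x : M) (v w : TangentSpace I x),
    ‖S.nablaJ x v w‖ ^ 2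
      = μ ^ 2 * (‖v‖ ^ 2 * ‖w‖ ^ 2 - (inner ℝ v w : ℝ) ^ 2 - S.sigma x v w ^ 2)

end OrthogonalAlmostComplexStructure

end RiemannianGeometry

/-! ### Hermitian linear algebra in real dimension six -/

section HermitianAlgebra

variable {V : Type*} [NormedAddCommGroup V] [InnerProductSpace ℝ V]

local notation "⟪" x "," y "⟫" => inner ℝ x y

/-- An orthogonal complex structure on a Euclidean vector space. -/
structure IsOrthogonalComplex (J : V →ₗ[ℝ] V) : Prop where
  sq : ∀ v, J (J v) = -v
  inner_map_map : ∀ v w, ⟪J v, J w⟫ = ⟪v, w⟫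

/-- A skew-symmetric product `A` with `⟪A u v, w⟫` a three-form of type `(3,0) + (0,3)`. -/
structure IsComplexCrossProduct (J : V →ₗ[ℝ] V) (A : V →ₗ[ℝ] V →ₗ[ℝ] V) : Prop where
  self : ∀ v, A v v = 0
  skew : ∀ u v w, ⟪A u v, w⟫ = -⟪v, A u w⟫
  map_J : ∀ u v, A u (J v) = -J (A u v)

namespace IsOrthogonalComplex

variable {J : V →ₗ[ℝ] V} (hJ : IsOrthogonalComplex J)
include hJ

lemma inner_left (v w : V) : ⟪J v, w⟫ = -⟪v, J w⟫ := by
  have := hJ.inner_map_map v (J w)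
  rw [hJ.sq, inner_neg_right] at this
  linarith

lemma inner_self (v : V) : ⟪v, J v⟫ = 0 := by
  have := hJ.inner_left v v
  rw [real_inner_comm] at this
  linarith

end IsOrthogonalComplex

lemma exists_unit_orthogonal [FiniteDimensional ℝ V] {ι : Type*} [Fintype ι] (f : ι → V)
    (h : Fintype.card ι < finrank ℝ V) : ∃ v : V, ⟪v, v⟫ = 1 ∧ ∀ i, ⟪f i, v⟫ = 0 := by
  set W := Submodule.span ℝ (Set.range f)
  have hW : W ≠ ⊤ := by
    intro hW
    have h1 := finrank_range_le_card (R := ℝ) f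
    rw [Set.finrank, show Submodule.span ℝ (Set.range f) = ⊤ from hW, finrank_top] at h1
    omega
  obtain ⟨v, hv, hv0⟩ := Submodule.exists_mem_ne_zero_of_ne_bot
    (mt W.orthogonal_eq_bot_iff.1 hW)
  have hn : ‖v‖ ≠ 0 := norm_ne_zero_iff.2 hv0
  refine ⟨‖v‖⁻¹ • v, ?_, fun i => ?_⟩
  · rw [real_inner_smul_left, real_inner_smul_right, real_inner_self_eq_norm_sq]
    field_simp
  · rw [real_inner_smul_right, (W.mem_orthogonal v).1 hv _ (Submodule.subset_span ⟨i, rfl⟩),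
      mul_zero]

/-- A six-dimensional Hermitian space has a unitary basis. -/
lemma IsOrthogonalComplex.exists_unitary_basis [FiniteDimensional ℝ V]
    (hV : finrank ℝ V = 6) {J : V →ₗ[ℝ] V} (hJ : IsOrthogonalComplex J) :
    ∃ b : OrthonormalBasis (Fin 3 ⊕ Fin 3) ℝ V, ∀ i, b (.inr i) = J (b (.inl i)) := by
  obtain ⟨x, hx, -⟩ := exists_unit_orthogonal (V := V) (ι := Fin 0) ![] (by simp [hV])
  obtain ⟨y, hy, hy'⟩ := exists_unit_orthogonal ![x, J x] (by simp [hV])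
  obtain ⟨z, hz, hz'⟩ := exists_unit_orthogonal ![x, J x, y, J y] (by simp [hV])
  simp only [Fin.forall_fin_succ, Matrix.cons_val_zero, Matrix.cons_val_succ] at hy' hz'
  obtain ⟨hxy, hxy', -⟩ := hy'
  obtain ⟨hxz, hxz', hyz, hyz', -⟩ := hz'
  let e : Fin 3 → V := ![x, y, z]
  have h1 : ∀ i j, ⟪e i, e j⟫ = if i = j then 1 else 0 := by
    intro i j
    fin_cases i <;> fin_cases j <;>
      simp [e, hx, hy, hz, hxy, hxz, hyz, -inner_self_eq_norm_sq_to_K,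
        real_inner_comm x y, real_inner_comm x z, real_inner_comm y z]
  have h2 : ∀ i j, ⟪J (e i), e j⟫ = 0 := by
    have key : ∀ u v : V, ⟪J u, v⟫ = 0 → ⟪J v, u⟫ = 0 := fun u v h => by
      rw [hJ.inner_left, real_inner_comm, h, neg_zero]
    have key' : ∀ u : V, ⟪J u, u⟫ = 0 := fun u => by
      rw [real_inner_comm, hJ.inner_self]
    intro i j
    fin_cases i <;> fin_cases j <;> simp only [e] <;>
      first | exact key' _ | assumption | (apply key; assumption)
  have horth : Orthonormal ℝ (Sum.elim e (fun i => J (e i))) := by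
    rw [orthonormal_iff_ite]
    rintro (i | i) (j | j)
    · simpa using h1 i j
    · simpa [real_inner_comm] using h2 j i
    · simpa using h2 i j
    · simpa [hJ.inner_map_map] using h1 i j
  have hcard : Fintype.card (Fin 3 ⊕ Fin 3) = finrank ℝ V := by simp [hV]
  refine ⟨(basisOfOrthonormalOfCardEqFinrank horth hcard).toOrthonormalBasis (by simpa using horth),
    fun i => by simp⟩

namespace IsComplexCrossProduct

variable {J : V →ₗ[ℝ] V} {A : V →ₗ[ℝ] V →ₗ[ℝ] V}

lemma swap (hA : IsComplexCrossProduct J A) (u v : V) : A u v = -A v u := by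
  have := hA.self (u + v)
  simp only [map_add, LinearMap.add_apply, hA.self, zero_add, add_zero] at this
  exact eq_neg_of_add_eq_zero_right this

lemma cycle (hA : IsComplexCrossProduct J A) (u v w : V) : ⟪A u v, w⟫ = ⟪A w u, v⟫ := by
  rw [hA.skew, hA.swap w u, inner_neg_left, real_inner_comm]

lemma map_J_left (hA : IsComplexCrossProduct J A) (u v : V) : A (J u) v = -J (A u v) := by
  rw [hA.swap, hA.map_J, hA.swap v u, map_neg, neg_neg]

/-- In dimension six, inner products of values of a complex cross product. -/
theorem exists_inner_eq [FiniteDimensional ℝ V] (hV : finrank ℝ V = 6)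
    (hJ : IsOrthogonalComplex J) (hA : IsComplexCrossProduct J A) :
    ∃ (b : OrthonormalBasis (Fin 3 ⊕ Fin 3) ℝ V) (a c : ℝ), (∀ i, b (.inr i) = J (b (.inl i))) ∧
      A (b (.inl 0)) (b (.inl 1)) = a • b (.inl 2) + c • b (.inr 2) ∧
      A (b (.inl 1)) (b (.inl 2)) = a • b (.inl 0) + c • b (.inr 0) ∧
      A (b (.inl 2)) (b (.inl 0)) = a • b (.inl 1) + c • b (.inr 1) ∧
      ∀ u v w z, ⟪A u v, A w z⟫ = (a ^ 2 + c ^ 2) * (⟪u, w⟫ * ⟪v, z⟫ - ⟪J u, w⟫ * ⟪J v, z⟫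
        - ⟪u, z⟫ * ⟪v, w⟫ + ⟪J u, z⟫ * ⟪J v, w⟫) := by
  obtain ⟨b, hb⟩ := hJ.exists_unitary_basis hV
  have hAJ : ∀ u v w, ⟪A u v, J w⟫ = ⟪A (J u) v, w⟫ := fun u v w => by
    rw [hA.map_J_left, inner_neg_left, hJ.inner_left, neg_neg]
  have hself : ∀ u v, ⟪A u v, u⟫ = 0 := fun u v => by rw [hA.cycle, hA.self, inner_zero_left]
  have hself' : ∀ u v, ⟪A u v, v⟫ = 0 := fun u v => by rw [hA.swap, inner_neg_left, hself, neg_zero]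
  have hselfJ : ∀ u v, ⟪A u v, J u⟫ = 0 := fun u v => by
    rw [hA.cycle, hA.map_J_left, hA.self]; simp
  have hselfJ' : ∀ u v, ⟪A u v, J v⟫ = 0 := fun u v => by
    rw [hA.swap, inner_neg_left, hselfJ, neg_zero]
  have hexp : ∀ x : V, x = ⟪x, b (.inl 0)⟫ • b (.inl 0) + ⟪x, b (.inl 1)⟫ • b (.inl 1)
      + ⟪x, b (.inl 2)⟫ • b (.inl 2) + ⟪x, b (.inr 0)⟫ • b (.inr 0) + ⟪x, b (.inr 1)⟫ • b (.inr 1)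
      + ⟪x, b (.inr 2)⟫ • b (.inr 2) := fun x => by
    conv_lhs => rw [← b.sum_repr' x]
    simp only [Fintype.sum_sum_type, Fin.sum_univ_three, real_inner_comm x]
    abel
  have hinn : ∀ x y : V, ⟪x, y⟫ = ⟪x, b (.inl 0)⟫ * ⟪y, b (.inl 0)⟫
      + ⟪x, b (.inl 1)⟫ * ⟪y, b (.inl 1)⟫ + ⟪x, b (.inl 2)⟫ * ⟪y, b (.inl 2)⟫
      + ⟪x, b (.inr 0)⟫ * ⟪y, b (.inr 0)⟫ + ⟪x, b (.inr 1)⟫ * ⟪y, b (.inr 1)⟫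
      + ⟪x, b (.inr 2)⟫ * ⟪y, b (.inr 2)⟫ := fun x y => by
    rw [← b.sum_inner_mul_inner x y]
    simp only [Fintype.sum_sum_type, Fin.sum_univ_three, real_inner_comm y]
    ring
  set a := ⟪A (b (.inl 0)) (b (.inl 1)), b (.inl 2)⟫ with ha
  set c := ⟪A (b (.inl 0)) (b (.inl 1)), b (.inr 2)⟫ with hc
  have h01 : A (b (.inl 0)) (b (.inl 1)) = a • b (.inl 2) + c • b (.inr 2) := by
    rw [hexp (A (b (.inl 0)) (b (.inl 1))), ← ha, ← hc]
    simp only [hb, hself, hself', hselfJ, hselfJ', zero_smul, zero_add, add_zero]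
  have h12 : A (b (.inl 1)) (b (.inl 2)) = a • b (.inl 0) + c • b (.inr 0) := by
    rw [hexp (A (b (.inl 1)) (b (.inl 2)))]
    have e1 : ⟪A (b (.inl 1)) (b (.inl 2)), b (.inl 0)⟫ = a := by rw [hA.cycle]
    have e2 : ⟪A (b (.inl 1)) (b (.inl 2)), b (.inr 0)⟫ = c := by
      rw [hb, hA.cycle, ← hAJ, ← hb]
    simp only [e1, e2]
    simp only [hb, hself, hself', hselfJ, hselfJ', zero_smul, add_zero]
  have h20 : A (b (.inl 2)) (b (.inl 0)) = a • b (.inl 1) + c • b (.inr 1) := by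
    rw [hexp (A (b (.inl 2)) (b (.inl 0)))]
    have e1 : ⟪A (b (.inl 2)) (b (.inl 0)), b (.inl 1)⟫ = a := by rw [← hA.cycle]
    have e2 : ⟪A (b (.inl 2)) (b (.inl 0)), b (.inr 1)⟫ = c := by
      rw [hb, hAJ, ← hA.cycle, ← hb]
    simp only [e1, e2]
    simp only [hb, hself, hself', hselfJ, hselfJ', zero_smul, zero_add, add_zero]
  have h10 := hA.swap (b (.inl 1)) (b (.inl 0))
  have h21 := hA.swap (b (.inl 2)) (b (.inl 1))
  have h02 := hA.swap (b (.inl 0)) (b (.inl 2))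
  rw [h01] at h10
  rw [h12] at h21
  rw [h20] at h02
  refine ⟨b, a, c, hb, h01, h12, h20, fun u v w z => ?_⟩
  have hcoord : ∀ (k : Fin 3 ⊕ Fin 3) (u v : V), ⟪A u v, b k⟫
      = ⟪u, A (b (.inl 0)) (b k)⟫ * ⟪v, b (.inl 0)⟫ + ⟪u, A (b (.inl 1)) (b k)⟫ * ⟪v, b (.inl 1)⟫
      + ⟪u, A (b (.inl 2)) (b k)⟫ * ⟪v, b (.inl 2)⟫ + ⟪u, A (b (.inr 0)) (b k)⟫ * ⟪v, b (.inr 0)⟫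
      + ⟪u, A (b (.inr 1)) (b k)⟫ * ⟪v, b (.inr 1)⟫
      + ⟪u, A (b (.inr 2)) (b k)⟫ * ⟪v, b (.inr 2)⟫ := fun k u v => by
    rw [hA.cycle, hinn]
    simp only [hA.cycle (b k) u, real_inner_comm u]
  have hJb : ∀ (i : Fin 3), J (b (.inr i)) = -b (.inl i) := fun i => by rw [hb, hJ.sq]
  have hAr : ∀ (i : Fin 3) (v : V), A (b (.inr i)) v = -J (A (b (.inl i)) v) := fun i v => by
    rw [hb, hA.map_J_left]
  have hAr' : ∀ (i : Fin 3) (v : V), A v (b (.inr i)) = -J (A v (b (.inl i))) := fun i v => by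
    rw [hb, hA.map_J]
  have hJl : ∀ (x : V) i, ⟪J x, b (.inl i)⟫ = -⟪x, b (.inr i)⟫ := fun x i => by
    rw [hJ.inner_left, hb]
  have hJr : ∀ (x : V) i, ⟪J x, b (.inr i)⟫ = ⟪x, b (.inl i)⟫ := fun x i => by
    rw [hb, hJ.inner_map_map]
  rw [hinn (A u v), hinn u w, hinn v z, hinn (J u) w, hinn (J v) z, hinn u z, hinn v w,
    hinn (J u) z, hinn (J v) w]
  simp only [hcoord, hAr, hAr', hJl, hJr, hA.self, h01, h12, h20, h10, h21, h02, map_add, map_neg,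
    map_smul, map_zero, hJb, ← hb, inner_add_right, inner_neg_right, real_inner_smul_right,
    inner_zero_right, neg_neg, neg_zero]
  ring

end IsComplexCrossProduct

end HermitianAlgebra

/-! ### Algebraic curvature tensors -/

section CurvatureAlgebra

variable {V : Type*} [NormedAddCommGroup V] [InnerProductSpace ℝ V]

local notation "⟪" x "," y "⟫" => inner ℝ x y

lemma pair_symm_of_bianchi {V : Type*} {R : V → V → V → V → ℝ}
    (h12 : ∀ u v w z, R u v w z = -R v u w z) (h34 : ∀ u v w z, R u v w z = -R u v z w)
    (hB : ∀ u v w z, R u v w z + R v w u z + R w u v z = 0) (u v w z : V) :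
    R u v w z = R w z u v := by
  linarith [hB u v w z, hB v w z u, hB w z u v, hB z u v w, h12 u v w z, h34 u v w z,
    h12 v w u z, h34 v w u z, h12 w u v z, h34 w u v z, h12 w z u v, h34 w z u v, h12 v w z u,
    h34 v w z u, h12 z v w u, h34 z v w u, h34 v z w u, h12 w z v u, h34 w z v u, h12 z u w v,
    h34 z u w v, h12 u w z v, h34 u w z v, h12 z u v w, h34 z u v w, h12 u v z w, h12 v z u w,
    h34 v z u w, h12 z v u w, h12 w u z v, h12 u z w v, h34 u z v w, h12 u z v w]

lemma swap_of_sectional_eq_zero {T : V → V → V → V → ℝ}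
    (hadd : ∀ u u' v w z, T (u + u') v w z = T u v w z + T u' v w z)
    (h12 : ∀ u v w z, T u v w z = -T v u w z) (hp : ∀ u v w z, T u v w z = T w z u v)
    (h0 : ∀ u v, T u v u v = 0) (u v w z : V) : T u v w z = -T w v u z := by
  have hadd2 : ∀ u v v' w z, T u (v + v') w z = T u v w z + T u v' w z := fun u v v' w z => by
    rw [h12, hadd, h12 v, h12 v']; ring
  have hadd3 : ∀ u v w w' z, T u v (w + w') z = T u v w z + T u v w' z := fun u v w w' z => by
    rw [hp, hadd, hp w, hp w']
  have hadd4 : ∀ u v w z z', T u v w (z + z') = T u v w z + T u v w z' := fun u v w z z' => by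
    rw [hp, hadd2, hp w, hp w]
  have h1 : ∀ u v z, T u v u z = 0 := fun u v z => by
    have := h0 u (v + z)
    rw [hadd2, hadd4, hadd4, h0, h0] at this
    linarith [hp u v u z]
  have := h1 (u + w) v z
  rw [hadd, hadd3, hadd3, h1, h1] at this
  linarith

/-- The curvature operator of the unit sphere, `(u, v, w) ↦ ⟪v, w⟫ u - ⟪u, w⟫ v`. -/
noncomputable def unitCurvature (V : Type*) [NormedAddCommGroup V] [InnerProductSpace ℝ V] :
    V →ₗ[ℝ] V →ₗ[ℝ] V →ₗ[ℝ] V :=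
  LinearMap.mk₂ ℝ (fun u v => (innerₗ V v).smulRight u - (innerₗ V u).smulRight v)
    (fun u u' v => by ext w; simp; module)
    (fun c u v => by ext w; simp; module)
    (fun u v v' => by ext w; simp; module)
    (fun c u v => by ext w; simp; module)

@[simp] lemma unitCurvature_apply (u v w : V) :
    unitCurvature V u v w = (⟪v, w⟫ : ℝ) • u - (⟪u, w⟫ : ℝ) • v := rfl

/-- A trilinear operator with the symmetries of a Riemann curvature tensor. -/
structure IsCurvatureOperator (R : V →ₗ[ℝ] V →ₗ[ℝ] V →ₗ[ℝ] V) : Prop where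
  swap : ∀ u v w, R u v w = -R v u w
  skew : ∀ u v w z, ⟪R u v w, z⟫ = -⟪w, R u v z⟫
  bianchi : ∀ u v w, R u v w + R v w u + R w u v = 0

lemma isCurvatureOperator_unitCurvature : IsCurvatureOperator (unitCurvature V) where
  swap u v w := by simp
  skew u v w z := by
    simp [inner_sub_left, inner_sub_right, inner_smul_left, inner_smul_right, real_inner_comm]
    ring
  bianchi u v w := by
    simp only [unitCurvature_apply, real_inner_comm u, real_inner_comm v w]
    module

namespace IsCurvatureOperator

variable {R R' : V →ₗ[ℝ] V →ₗ[ℝ] V →ₗ[ℝ] V}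

lemma sub_smul (hR : IsCurvatureOperator R) (hR' : IsCurvatureOperator R') (m : ℝ) :
    IsCurvatureOperator (R - m • R') where
  swap u v w := by
    simp only [LinearMap.sub_apply, LinearMap.smul_apply, hR.swap u v, hR'.swap u v]; module
  skew u v w z := by
    simp only [LinearMap.sub_apply, LinearMap.smul_apply, inner_sub_left, inner_sub_right,
      inner_smul_left, inner_smul_right, hR.skew, hR'.skew u v]
    simp; ring
  bianchi u v w := by
    have h := hR.bianchi u v w
    have h' := congrArg (m • ·) (hR'.bianchi u v w)
    simp only [smul_add, smul_zero] at h'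
    simp only [LinearMap.sub_apply, LinearMap.smul_apply]
    rw [← sub_eq_zero.2 (h.trans h'.symm)]
    abel

lemma inner_swap (hR : IsCurvatureOperator R) (u v w z : V) :
    ⟪R u v w, z⟫ = -⟪R v u w, z⟫ := by rw [hR.swap, inner_neg_left]

lemma inner_skew (hR : IsCurvatureOperator R) (u v w z : V) :
    ⟪R u v w, z⟫ = -⟪R u v z, w⟫ := by rw [hR.skew, real_inner_comm]

lemma inner_bianchi (hR : IsCurvatureOperator R) (u v w z : V) :
    ⟪R u v w, z⟫ + ⟪R v w u, z⟫ + ⟪R w u v, z⟫ = 0 := by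
  rw [← inner_add_left, ← inner_add_left, hR.bianchi, inner_zero_left]

lemma pair_symm (hR : IsCurvatureOperator R) (u v w z : V) : ⟪R u v w, z⟫ = ⟪R w z u, v⟫ :=
  pair_symm_of_bianchi (R := fun u v w z => ⟪R u v w, z⟫) hR.inner_swap hR.inner_skew
    hR.inner_bianchi u v w z

/-- In dimension six, a curvature tensor whose commutator with `J` is the alternation of a
three-form of type `(3,0) + (0,3)` with values in covectors is of Kähler type. -/
theorem kahler_of_alternation [FiniteDimensional ℝ V] (hV : finrank ℝ V = 6) {J : V →ₗ[ℝ] V}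
    (hJ : IsOrthogonalComplex J) (hR : IsCurvatureOperator R) {d : V → V → V → V → ℝ}
    (hd23 : ∀ u v w z, d u v w z = -d u w v z) (hd34 : ∀ u v w z, d u v w z = -d u v z w)
    (hdJ : ∀ u v w z, d u v (J w) z = d u v w (J z))
    (hRd : ∀ u v w z, ⟪R u v (J w), z⟫ + ⟪R u v w, J z⟫ = d u v w z - d v u w z) :
    (∀ u v w z, d u v w z = 0) ∧ ∀ u v w z, ⟪R u v (J w), J z⟫ = ⟪R u v w, z⟫ := by
  have h1 : ∀ u v w z, ⟪R u v (J w), J z⟫ - ⟪R u v w, z⟫ = d u v w (J z) - d v u w (J z) := by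
    intro u v w z
    rw [← hRd, hJ.sq, inner_neg_right]
    ring
  have h2 : ∀ u v, ⟪R u v (J u), J v⟫ = ⟪R u v u, v⟫ := fun u v => by
    have := h1 u v u v
    rw [← hdJ u] at this
    linarith [hd23 u v (J u) v, hd34 u (J u) v v, hd23 v u u (J v)]
  have hS : ∀ u v w z, ⟪R (J u) (J v) (J w), J z⟫ = ⟪R u v w, z⟫ := by
    intro u v w z
    have h0 : ∀ u v, ⟪R (J u) (J v) (J u), J v⟫ = ⟪R u v u, v⟫ := fun u v => by
      have := h2 (J u) (J v)
      rw [hJ.sq, hJ.sq, map_neg, inner_neg_neg] at this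
      rw [← this, hR.pair_symm, h2]
    let S : V → V → V → V → ℝ := fun u v w z => ⟪R (J u) (J v) (J w), J z⟫ - ⟪R u v w, z⟫
    have s12 : ∀ u v w z, S u v w z = -S v u w z := fun u v w z => by
      simp only [S, hR.inner_swap (J u), hR.inner_swap u]; ring
    have s34 : ∀ u v w z, S u v w z = -S u v z w := fun u v w z => by
      simp only [S, hR.inner_skew _ _ (J w), hR.inner_skew _ _ w]; ring
    have sp : ∀ u v w z, S u v w z = S w z u v := fun u v w z => by
      simp only [S, hR.pair_symm (J u), hR.pair_symm u]
    have s13 := swap_of_sectional_eq_zero (T := S)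
      (fun u u' v w z => by simp only [S, map_add, LinearMap.add_apply, inner_add_left]; ring)
      s12 sp (fun u v => by simp only [S, h0, sub_self])
    have sB : S u v w z + S v w u z + S w u v z = 0 := by
      have e1 := hR.inner_bianchi u v w z
      have e2 := hR.inner_bianchi (J u) (J v) (J w) (J z)
      simp only [S]; linarith
    have : S u v w z = 0 := by
      linarith [s13 v w u z, s12 u w v z, s12 v w u z, s13 w u v z, s12 w u v z, s13 u w v z,
        s12 v u w z, s13 v u w z, s12 w v u z, s13 u v w z]
    exact sub_eq_zero.1 this
  let T : V → V → LinearMap.BilinForm ℝ V := fun u v =>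
    ((innerₗ V).comp (R u v)) - ((innerₗ V).comp (R u v)).compl₁₂ J J
  have hT : ∀ u v w z, T u v w z = ⟪R u v w, z⟫ - ⟪R u v (J w), J z⟫ := fun u v w z => rfl
  have t12 : ∀ u v w z, T u v w z = -T v u w z := fun u v w z => by
    simp only [hT, hR.inner_swap u]; ring
  have t34 : ∀ u v w z, T u v w z = -T u v z w := fun u v w z => by
    simp only [hT, hR.inner_skew _ _ (J w), hR.inner_skew _ _ w]; ring
  have tp : ∀ u v w z, T u v w z = T w z u v := fun u v w z => by
    simp only [hT]
    rw [hR.pair_symm u, ← hS u v (J w) (J z), hJ.sq, hJ.sq, map_neg, inner_neg_neg,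
      hR.pair_symm (J u)]
  have t13 := swap_of_sectional_eq_zero (T := fun u v w z => T u v w z)
    (fun u u' v w z => by simp only [hT, map_add, LinearMap.add_apply, inner_add_left]; ring)
    t12 tp (fun u v => by simp only [hT, h2, sub_self])
  have tJ : ∀ u w z, T u (J u) w z = 0 := fun u w z => by
    rw [tp]
    simp only [hT, hJ.sq, inner_neg_right]
    linarith [hR.inner_skew w z (J u) u]
  have tself : ∀ u w z, T u u w z = 0 := fun u w z => by linarith [t12 u u w z]
  obtain ⟨b, hb⟩ := hJ.exists_unitary_basis hV
  let p : Fin 3 ⊕ Fin 3 → Fin 3 := Sum.elim id id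
  have tb : ∀ i j w z, p i = p j → T (b i) (b j) w z = 0 := by
    rintro (i | i) (j | j) w z h <;> simp only [p, Sum.elim_inl, Sum.elim_inr, id] at h <;> subst h
    · exact tself _ _ _
    · rw [hb]; exact tJ _ _ _
    · rw [t12, hb, tJ, neg_zero]
    · exact tself _ _ _
  have tbasis : ∀ i j k l, T (b i) (b j) (b k) (b l) = 0 := by
    intro i j k l
    have hc : p i = p j ∨ p i = p k ∨ p i = p l ∨ p j = p k ∨ p j = p l ∨ p k = p l := by omega
    rcases hc with h | h | h | h | h | h
    · exact tb _ _ _ _ h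
    · rw [t12, t13, t12, tb _ _ _ _ h]; simp
    · rw [t34, t12, t13, t12, tb _ _ _ _ h]; simp
    · rw [t13, tb _ _ _ _ h.symm, neg_zero]
    · rw [t34, t13, tb _ _ _ _ h.symm]; simp
    · rw [tp, tb _ _ _ _ h]
  have tzero : ∀ u v w z, T u v w z = 0 := by
    have e1 : ∀ i j, T (b i) (b j) = 0 := fun i j =>
      LinearMap.BilinForm.ext_basis b.toBasis fun k l => by simpa using tbasis i j k l
    have e2 : ∀ w z, T w z = 0 := fun w z =>
      LinearMap.BilinForm.ext_basis b.toBasis fun k l => by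
        have := tp w z (b k) (b l)
        rw [e1] at this
        simpa using this
    intro u v w z
    rw [e2]; rfl
  have hd12 : ∀ u v w z, d u v w z = d v u w z := fun u v w z => by
    have := h1 u v w (-J z)
    have hz := tzero u v w (-J z)
    rw [hT] at hz
    have hJz : J (-J z) = z := by rw [map_neg, hJ.sq, neg_neg]
    rw [hJz] at this hz
    linarith
  refine ⟨fun u v w z => ?_, fun u v w z => ?_⟩
  · linarith [hd12 u v w z, hd23 v u w z, hd12 v w u z, hd23 w v u z, hd12 w u v z, hd23 u w v z]
  · have := tzero u v w z
    rw [hT] at this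
    linarith

/-- The trace of a bilinear form does not depend on the orthonormal basis. -/
lemma _root_.OrthonormalBasis.sum_bilin_eq {ι κ : Type*} [Fintype ι] [Fintype κ]
    (b : OrthonormalBasis ι ℝ V) (b' : OrthonormalBasis κ ℝ V) (f : V →ₗ[ℝ] V →ₗ[ℝ] ℝ) :
    ∑ i, f (b i) (b i) = ∑ j, f (b' j) (b' j) := by
  have h : ∀ i, f (b i) (b i) = ∑ j, ⟪b' j, b i⟫ * f (b' j) (b i) := fun i => by
    conv_lhs => enter [1]; rw [← b'.sum_repr' (b i)]
    simp [LinearMap.sum_apply]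
  simp_rw [h]
  rw [Finset.sum_comm]
  refine Finset.sum_congr rfl fun j _ => ?_
  conv_rhs => enter [2]; rw [← b.sum_repr' (b' j)]
  simp [real_inner_comm]

/-- The Ricci tensor of a curvature tensor of Kähler type vanishes if the complex traces of its
curvature operators do. -/
lemma ricci_eq_zero_of_kahler {J : V →ₗ[ℝ] V} (hJ : IsOrthogonalComplex J)
    (hR : IsCurvatureOperator R) (hK : ∀ u v w z, ⟪R u v (J w), J z⟫ = ⟪R u v w, z⟫)
    (b : OrthonormalBasis (Fin 3 ⊕ Fin 3) ℝ V) (hb : ∀ i, b (.inr i) = J (b (.inl i)))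
    (ht : ∀ u v, ∑ i : Fin 3, ⟪R u v (b (.inl i)), b (.inr i)⟫ = 0) (u v : V) :
    ∑ k, ⟪R u (b k) (b k), v⟫ = 0 := by
  have key : ∀ e, ⟪R u (J v) e, J e⟫ = -⟪R u (J e) (J e), v⟫ - ⟪R u e e, v⟫ := fun e => by
    have h1 := hR.inner_bianchi u (J v) e (J e)
    have h2 : ⟪R e u (J v), J e⟫ = ⟪R u e e, v⟫ := by
      rw [hK, hR.inner_swap, hR.inner_skew, neg_neg]
    have h3 : ⟪R (J v) e u, J e⟫ = ⟪R u (J e) (J e), v⟫ := by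
      have e1 := hK u (J e) (J v) e
      have e2 := hR.inner_skew u (J e) v (J e)
      rw [hJ.sq, map_neg, inner_neg_left] at e1
      rw [hR.pair_symm]
      linarith
    linarith
  have h := ht u (J v)
  simp only [hb, key, Finset.sum_sub_distrib, Finset.sum_neg_distrib] at h
  rw [Fintype.sum_sum_type]
  simp only [hb]
  linarith

end IsCurvatureOperator

/-- A skew derivation of a non-zero complex cross product in dimension six has complex trace
zero. -/
lemma IsComplexCrossProduct.trace_derivation_eq_zero {J : V →ₗ[ℝ] V} {A : V →ₗ[ℝ] V →ₗ[ℝ] V}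
    (hJ : IsOrthogonalComplex J) (hA : IsComplexCrossProduct J A)
    (b : OrthonormalBasis (Fin 3 ⊕ Fin 3) ℝ V) (hb : ∀ i, b (.inr i) = J (b (.inl i))) {a c : ℝ}
    (hac : a ^ 2 + c ^ 2 ≠ 0)
    (h01 : A (b (.inl 0)) (b (.inl 1)) = a • b (.inl 2) + c • b (.inr 2))
    (h12 : A (b (.inl 1)) (b (.inl 2)) = a • b (.inl 0) + c • b (.inr 0))
    (h20 : A (b (.inl 2)) (b (.inl 0)) = a • b (.inl 1) + c • b (.inr 1))
    {L : V →ₗ[ℝ] V} (hL : ∀ u v, ⟪L u, v⟫ = -⟪u, L v⟫)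
    (hLA : ∀ u v, L (A u v) = A (L u) v + A u (L v)) :
    ∑ i : Fin 3, ⟪L (b (.inl i)), b (.inr i)⟫ = 0 := by
  have key : ∀ u v w, ⟪A u v, L w⟫ + ⟪A v w, L u⟫ + ⟪A w u, L v⟫ = 0 := fun u v w => by
    have h := hL (A u v) w
    rw [hLA, inner_add_left] at h
    linarith [hA.cycle v w (L u), hA.cycle u (L v) w]
  have hLs : ∀ u, ⟪u, L u⟫ = 0 := fun u => by
    have := hL u u
    rw [real_inner_comm] at this
    linarith
  have k1 := key (b (.inl 0)) (b (.inl 1)) (b (.inl 2))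
  have k2 := key (b (.inl 0)) (b (.inl 1)) (b (.inr 2))
  have hJb : ∀ i : Fin 3, J (b (.inr i)) = -b (.inl i) := fun i => by rw [hb, hJ.sq]
  have e1 : A (b (.inl 1)) (b (.inr 2)) = c • b (.inl 0) - a • b (.inr 0) := by
    rw [hb, hA.map_J, h12, map_add, map_smul, map_smul, ← hb, hJb]
    module
  have e2 : A (b (.inr 2)) (b (.inl 0)) = c • b (.inl 1) - a • b (.inr 1) := by
    rw [hb, hA.map_J_left, h20, map_add, map_smul, map_smul, ← hb, hJb]
    module
  rw [h01, h12, h20] at k1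
  rw [h01, e1, e2] at k2
  simp only [inner_add_left, inner_sub_left, real_inner_smul_left, hLs] at k1 k2
  rw [Fin.sum_univ_three]
  have hs : ∀ i, ⟪b (.inr i), L (b (.inl i))⟫ = ⟪L (b (.inl i)), b (.inr i)⟫ := fun i =>
    real_inner_comm _ _
  have hs' : ⟪b (.inl 2), L (b (.inr 2))⟫ = -⟪L (b (.inl 2)), b (.inr 2)⟫ := by rw [hL, neg_neg]
  rw [hs, hs, hs] at k1
  rw [hs', hs, hs] at k2
  refine (mul_eq_zero.1 ?_).resolve_left hac
  linear_combination c * k1 - a * k2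

end CurvatureAlgebra

/-! ### Smooth vector fields -/

section SmoothFields

open Filter Topology

variable {E : Type*} [NormedAddCommGroup E] [NormedSpace ℝ E] [FiniteDimensional ℝ E]
  {H : Type*} [TopologicalSpace H] {I : ModelWithCorners ℝ E H}
  {M : Type*} [TopologicalSpace M] [ChartedSpace H M] [IsManifold I ∞ M]

variable (I) in
/-- A globally smooth vector field. -/
def IsSmoothField (X : Π x : M, TangentSpace I x) : Prop :=
  ContMDiff I I.tangent ∞ (T% X)

namespace IsSmoothField

variable {X Y Z : Π x : M, TangentSpace I x} {f : M → ℝ}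

lemma contMDiff (hX : IsSmoothField I X) : ContMDiff I I.tangent ∞ (T% X) := hX

lemma mdiffAt (hX : IsSmoothField I X) (x : M) : MDiffAt (T% X) x :=
  hX.contMDiff.mdifferentiable (by simp) x

lemma add (hX : IsSmoothField I X) (hY : IsSmoothField I Y) :
    IsSmoothField I (fun y => X y + Y y) :=
  ContMDiff.add_section hX hY

lemma sub (hX : IsSmoothField I X) (hY : IsSmoothField I Y) :
    IsSmoothField I (fun y => X y - Y y) :=
  ContMDiff.sub_section hX hY

lemma neg (hX : IsSmoothField I X) : IsSmoothField I (fun y => -X y) :=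
  ContMDiff.neg_section hX

lemma smul (hf : ContMDiff I 𝓘(ℝ) ∞ f) (hX : IsSmoothField I X) :
    IsSmoothField I (fun y => f y • X y) :=
  ContMDiff.smul_section hf hX

lemma const_smul (c : ℝ) (hX : IsSmoothField I X) : IsSmoothField I (fun y => c • X y) :=
  smul contMDiff_const hX

lemma mlieBracket (hX : IsSmoothField I X) (hY : IsSmoothField I Y) :
    IsSmoothField I (mlieBracket I X Y) := by
  have h1 : IsManifold I (minSmoothness ℝ 2) M := by simp; infer_instance
  have h2 : IsManifold I (((⊤ : ℕ∞) : WithTop ℕ∞) + 1) M := ‹IsManifold I ∞ M›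
  exact ContDiff.mlieBracket_vectorField (m := ⊤) (n := ⊤) hX hY (by simp)

end IsSmoothField

/-- The derivative of a smooth function along a smooth field is smooth. -/
lemma contMDiff_mvfderiv {f : M → ℝ} {X : Π x : M, TangentSpace I x}
    (hf : ContMDiff I 𝓘(ℝ) ∞ f) (hX : IsSmoothField I X) :
    ContMDiff I 𝓘(ℝ) ∞ (fun y => d% f y (X y)) := by
  have h1 : ContMDiff I.tangent 𝓘(ℝ).tangent ∞ (tangentMap I 𝓘(ℝ) f) :=
    hf.contMDiff_tangentMap (by simp)
  have h2 := h1.comp hX.contMDiff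
  exact (contMDiff_snd_tangentBundle_modelSpace ℝ 𝓘(ℝ)).comp h2

variable (I) in
/-- Every tangent vector is the value of a globally smooth field. -/
lemma exists_isSmoothField [T2Space M] (x : M) (v : TangentSpace I x) :
    ∃ X : Π x : M, TangentSpace I x, IsSmoothField I X ∧ X x = v ∧ ∀ᶠ y in 𝓝 x,
      X y = extend E v y := by
  obtain ⟨s, hs, hsm⟩ := exists_contMDiffOn_extend (k := ∞) I E v
  obtain ⟨u, hus, hu, hxu⟩ := mem_nhds_iff.1 hs
  obtain ⟨φ, -, hφ⟩ := (SmoothBumpFunction.nhds_basis_tsupport (I := I) x).mem_iff.1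
    (hu.mem_nhds hxu)
  refine ⟨fun y => φ y • extend E v y, ?_, by simp, ?_⟩
  · exact ContMDiffOn.smul_section_of_tsupport φ.contMDiff.contMDiffOn hu hφ (hsm.mono hus)
  · filter_upwards [φ.eventuallyEq_one] with y hy
    simp [hy]

/-- A smoothly varying matrix has smooth determinant. -/
lemma contMDiff_det {n : Type*} [Fintype n] [DecidableEq n] {A : M → Matrix n n ℝ}
    (hA : ∀ i j, ContMDiff I 𝓘(ℝ) ∞ (fun x => A x i j)) :
    ContMDiff I 𝓘(ℝ) ∞ (fun x => (A x).det) := by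
  simp only [Matrix.det_apply']
  exact contMDiff_finsetSum fun σ _ => contMDiff_const.mul
    (contMDiff_finsetProd fun i _ => hA _ _)

variable [RiemannianBundle (fun x : M => TangentSpace I x)]
  [IsContMDiffRiemannianBundle I ∞ E (fun x : M => TangentSpace I x)]

lemma IsSmoothField.inner {X Y : Π x : M, TangentSpace I x} (hX : IsSmoothField I X)
    (hY : IsSmoothField I Y) : ContMDiff I 𝓘(ℝ) ∞ (fun y => inner ℝ (X y) (Y y)) :=
  ContMDiff.inner_bundle (IB := I) (F := E) (E := fun x : M => TangentSpace I x)
    (b := id) (v := X) (w := Y) hX hY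

/-- A field with smooth inner products against all smooth fields is smooth. -/
lemma isSmoothField_of_inner [T2Space M] {X : Π x : M, TangentSpace I x}
    (h : ∀ Z : Π x : M, TangentSpace I x, IsSmoothField I Z →
      ContMDiff I 𝓘(ℝ) ∞ (fun y => inner ℝ (X y) (Z y))) : IsSmoothField I X := by
  intro x
  let b := stdOrthonormalBasis ℝ (TangentSpace I x)
  choose s hs hsx _ using fun i => exists_isSmoothField I x (b i)
  let G : M → Matrix _ _ ℝ := fun y => Matrix.gram ℝ (fun i => s i y)
  have hG : ∀ i j, ContMDiff I 𝓘(ℝ) ∞ (fun y => G y i j) := fun i j => (hs i).inner (hs j)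
  have hdet : ContMDiff I 𝓘(ℝ) ∞ (fun y => (G y).det) := contMDiff_det hG
  have hne : ∀ᶠ y in 𝓝 x, (G y).det ≠ 0 := by
    refine hdet.continuous.continuousAt.eventually_ne ?_
    have : G x = 1 := by
      rw [Matrix.gram_eq_one_iff_orthonormal]
      simp only [hsx]
      exact b.orthonormal
    rw [this, Matrix.det_one]
    exact one_ne_zero
  have hr : ∀ i, ContMDiff I 𝓘(ℝ) ∞
      (fun y => ((G y).cramer (fun j => inner ℝ (X y) (s j y))) i) := fun i => by
    simp only [Matrix.cramer_apply]
    refine contMDiff_det fun j k => ?_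
    by_cases hk : k = i
    · subst hk
      simpa using h _ (hs j)
    · simpa [hk] using hG j k
  have heq : ∀ y, (G y).det ≠ 0 → X y = ∑ i, (((G y).det)⁻¹ *
      ((G y).cramer (fun j => inner ℝ (X y) (s j y))) i) • s i y := by
    intro y hy
    have hli : LinearIndependent ℝ (fun i => s i y) :=
      Matrix.linearIndependent_of_det_gram_ne_zero hy
    have hfr : finrank ℝ (TangentSpace I y) = finrank ℝ (TangentSpace I x) := rfl
    have hspan : Submodule.span ℝ (Set.range fun i => s i y) = ⊤ :=
      hli.span_eq_top_of_card_eq_finrank' (by simp [hfr])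
    have hx : X y ∈ Submodule.span ℝ (Set.range fun i => s i y) := hspan ▸ Submodule.mem_top
    obtain ⟨c, hc⟩ := (Submodule.mem_span_range_iff_exists_fun ℝ).1 hx
    have hGc : (G y).mulVec c = fun j => inner ℝ (X y) (s j y) := by
      ext j
      rw [← hc, sum_inner]
      simp [Matrix.mulVec, dotProduct, G, Matrix.gram_apply, inner_smul_left, mul_comm,
        real_inner_comm]
    have hcr : (G y).cramer (fun j => inner ℝ (X y) (s j y)) = (G y).det • c := by
      rw [← hGc, Matrix.cramer_eq_adjugate_mulVec, Matrix.mulVec_mulVec, Matrix.adjugate_mul,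
        Matrix.smul_mulVec, Matrix.one_mulVec]
    rw [hcr]
    simp only [Pi.smul_apply, smul_eq_mul, inv_mul_cancel_left₀ hy]
    exact hc.symm
  have hsm : ContMDiffAt I I.tangent ∞ (T% (fun y => ∑ i, (((G y).det)⁻¹ *
      ((G y).cramer (fun j => inner ℝ (X y) (s j y))) i) • s i y)) x := by
    refine ContMDiffAt.sum_section fun i _ => ?_
    refine ContMDiffAt.smul_section (ContMDiffAt.mul ?_ (hr i x)) (hs i x)
    exact (hdet x).inv₀ hne.self_of_nhds
  refine hsm.congr_of_eventuallyEq ?_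
  filter_upwards [hne] with y hy
  rw [TotalSpace.mk_inj]
  exact heq y hy

/-- `∇_X Y` for the Levi-Civita connection. -/
noncomputable def covDeriv (X Y : Π x : M, TangentSpace I x) : Π x : M, TangentSpace I x :=
  fun y => leviCivita I M Y y (X y)

lemma inner_covDeriv {X Y Z : Π x : M, TangentSpace I x} (hX : IsSmoothField I X)
    (hY : IsSmoothField I Y) (hZ : IsSmoothField I Z) (x : M) :
    inner ℝ (covDeriv X Y x) (Z x) = (1 / 2 : ℝ) * koszul I Y X Z x :=
  inner_leviCivitaFun (hY.mdiffAt x) (hX.mdiffAt x) (hZ.mdiffAt x)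

lemma IsSmoothField.covDeriv [T2Space M] {X Y : Π x : M, TangentSpace I x}
    (hX : IsSmoothField I X) (hY : IsSmoothField I Y) : IsSmoothField I (covDeriv X Y) := by
  refine isSmoothField_of_inner fun Z hZ => ?_
  simp only [inner_covDeriv hX hY hZ]
  refine contMDiff_const.mul ?_
  unfold koszul
  exact (((((contMDiff_mvfderiv (hY.inner hZ) hX).add (contMDiff_mvfderiv (hX.inner hZ) hY)).sub
    (contMDiff_mvfderiv (hX.inner hY) hZ)).add ((hX.mlieBracket hY).inner hZ)).sub
    ((hX.mlieBracket hZ).inner hY)).sub ((hY.mlieBracket hZ).inner hX)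

end SmoothFields

/-! ### Symmetries of the curvature tensor -/

section CurvatureSymmetries

open Filter Topology

variable {E : Type*} [NormedAddCommGroup E] [NormedSpace ℝ E] [FiniteDimensional ℝ E]
  {H : Type*} [TopologicalSpace H] {I : ModelWithCorners ℝ E H}
  {M : Type*} [TopologicalSpace M] [ChartedSpace H M] [IsManifold I ∞ M]
  [RiemannianBundle (fun x : M => TangentSpace I x)]
  [IsContMDiffRiemannianBundle I ∞ E (fun x : M => TangentSpace I x)]

variable {X Y Z W : Π x : M, TangentSpace I x} {f : M → ℝ}

lemma covDeriv_add (hY : IsSmoothField I Y) (hZ : IsSmoothField I Z) (x : M) :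
    covDeriv X (fun y => Y y + Z y) x = covDeriv X Y x + covDeriv X Z x := by
  have := (leviCivita I M).isCovariantDerivativeOnUniv.add (hY.mdiffAt x) (hZ.mdiffAt x)
  exact congrArg (· (X x)) this

lemma covDeriv_smul (hf : ContMDiff I 𝓘(ℝ) ∞ f) (hY : IsSmoothField I Y) (x : M) :
    covDeriv X (fun y => f y • Y y) x = d% f x (X x) • Y x + f x • covDeriv X Y x := by
  have := (leviCivita I M).isCovariantDerivativeOnUniv.leibniz (hY.mdiffAt x)
    (hf.mdifferentiable (by simp) x)
  rw [add_comm]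
  exact congrArg (· (X x)) this

lemma covDeriv_const_smul (c : ℝ) (hY : IsSmoothField I Y) (x : M) :
    covDeriv X (fun y => c • Y y) x = c • covDeriv X Y x := by
  rw [covDeriv_smul contMDiff_const hY, mvfderiv_const]
  simp

lemma covDeriv_neg (hY : IsSmoothField I Y) (x : M) :
    covDeriv X (fun y => -Y y) x = -covDeriv X Y x := by
  simpa using covDeriv_const_smul (X := X) (-1) hY x

lemma covDeriv_sub (hY : IsSmoothField I Y) (hZ : IsSmoothField I Z) (x : M) :
    covDeriv X (fun y => Y y - Z y) x = covDeriv X Y x - covDeriv X Z x := by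
  simp only [sub_eq_add_neg]
  rw [covDeriv_add hY hZ.neg, covDeriv_neg hZ]

lemma covDeriv_congr_left (x : M) (h : X x = Y x) : covDeriv X Z x = covDeriv Y Z x := by
  simp only [covDeriv, h]

lemma mvfderiv_inner (hX : IsSmoothField I X) (hY : IsSmoothField I Y) (hZ : IsSmoothField I Z)
    (x : M) : d% (fun y => inner ℝ (Y y) (Z y)) x (X x)
      = inner ℝ (covDeriv X Y x) (Z x) + inner ℝ (Y x) (covDeriv X Z x) :=
  leviCivita_metric (hX.mdiffAt x) (hY.mdiffAt x) (hZ.mdiffAt x)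

lemma mlieBracket_eq (hX : IsSmoothField I X) (hY : IsSmoothField I Y) :
    mlieBracket I X Y = fun y => covDeriv X Y y - covDeriv Y X y :=
  funext fun x => (leviCivita_torsionFree (hX.mdiffAt x) (hY.mdiffAt x)).symm

lemma mlieBracket_eq_apply (hX : IsSmoothField I X) (hY : IsSmoothField I Y) (x : M) :
    mlieBracket I X Y x = covDeriv X Y x - covDeriv Y X x := by
  rw [mlieBracket_eq hX hY]

lemma curvatureField_apply (x : M) : curvatureField I X Y Z x
    = covDeriv X (covDeriv Y Z) x - covDeriv Y (covDeriv X Z) x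
      - covDeriv (mlieBracket I X Y) Z x := rfl

lemma jacobi_mlieBracket (hX : IsSmoothField I X) (hY : IsSmoothField I Y)
    (hZ : IsSmoothField I Z) (x : M) : mlieBracket I X (mlieBracket I Y Z) x
      = mlieBracket I (mlieBracket I X Y) Z x + mlieBracket I Y (mlieBracket I X Z) x := by
  have : IsManifold I (minSmoothness ℝ 3) M := by simp; infer_instance
  have h : minSmoothness ℝ 2 ≤ ∞ := by simpa using ENat.LEInfty.out
  exact leibniz_identity_mlieBracket_apply ((hX.contMDiff x).of_le h) ((hY.contMDiff x).of_le h)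
    ((hZ.contMDiff x).of_le h)

variable [T2Space M]

/-- The Lie bracket acts on functions as the commutator of derivations. -/
lemma mvfderiv_mlieBracket (hf : ContMDiff I 𝓘(ℝ) ∞ f) (hX : IsSmoothField I X)
    (hY : IsSmoothField I Y) (x : M) :
    d% f x (mlieBracket I X Y x)
      = d% (fun y => d% f y (Y y)) x (X x) - d% (fun y => d% f y (X y)) x (Y x) := by
  by_cases hv : ∃ v : TangentSpace I x, v ≠ 0
  swap
  · push Not at hv
    rw [hv (mlieBracket I X Y x), hv (X x), hv (Y x)]
    simp
  obtain ⟨v, hv⟩ := hv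
  obtain ⟨Z, hZ, rfl, -⟩ := exists_isSmoothField I x v
  have hmf := fun y => hf.mdifferentiable (by simp) y
  have hbr : ∀ {X : Π x : M, TangentSpace I x}, mlieBracket I X (f • Z)
      = (fun y => d% f y (X y)) • Z + f • mlieBracket I X Z := fun {X} =>
    funext fun y => mlieBracket_smul_right (hmf y) (hZ.mdiffAt y)
  have hj := jacobi_mlieBracket hX hY (hZ.smul hf) x
  have hbr2 : ∀ {X Y : Π x : M, TangentSpace I x}, IsSmoothField I X → IsSmoothField I Y →
      mlieBracket I X (mlieBracket I Y (f • Z)) x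
        = d% (fun y => d% f y (Y y)) x (X x) • Z x + d% f x (Y x) • mlieBracket I X Z x
          + (d% f x (X x) • mlieBracket I Y Z x + f x • mlieBracket I X (mlieBracket I Y Z) x) := by
    intro X Y hX hY
    have hd := contMDiff_mvfderiv hf hY
    have hmd := hd.mdifferentiable (by simp) x
    have e1 : MDiffAt (T% ((fun y => d% f y (Y y)) • Z)) x := (hZ.smul hd).mdiffAt x
    have e2 : MDiffAt (T% (f • mlieBracket I Y Z)) x := ((hY.mlieBracket hZ).smul hf).mdiffAt x
    rw [hbr, mlieBracket_add_right e1 e2,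
      mlieBracket_smul_right hmd (hZ.mdiffAt x),
      mlieBracket_smul_right (hmf x) ((hY.mlieBracket hZ).mdiffAt x)]
  change mlieBracket I X (mlieBracket I Y (f • Z)) x = mlieBracket I (mlieBracket I X Y) (f • Z) x
    + mlieBracket I Y (mlieBracket I X (f • Z)) x at hj
  rw [hbr2 hX hY, hbr2 hY hX, hbr, jacobi_mlieBracket hX hY hZ] at hj
  simp only [Pi.add_apply, Pi.smul_apply'] at hj
  have h0 : (d% (fun y => d% f y (Y y)) x (X x) - d% (fun y => d% f y (X y)) x (Y x)
      - d% f x (mlieBracket I X Y x)) • Z x = 0 := by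
    rw [← sub_eq_zero] at hj
    rw [← hj]
    module
  linarith [(smul_eq_zero.1 h0).resolve_right hv]

lemma curvatureField_swap (x : M) : curvatureField I X Y Z x = -curvatureField I Y X Z x := by
  simp only [curvatureField_apply]
  rw [covDeriv_congr_left (Y := fun y => -mlieBracket I Y X y) x mlieBracket_swap_apply]
  simp only [covDeriv, map_neg]
  abel

lemma curvatureField_skew (hX : IsSmoothField I X) (hY : IsSmoothField I Y)
    (hZ : IsSmoothField I Z) (hW : IsSmoothField I W) (x : M) :
    inner ℝ (curvatureField I X Y Z x) (W x) = -(inner ℝ (Z x) (curvatureField I X Y W x) : ℝ) := by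
  have h := mvfderiv_mlieBracket (hZ.inner hW) hX hY x
  rw [mvfderiv_inner (hX.mlieBracket hY) hZ hW] at h
  have key : ∀ {X Y : Π x : M, TangentSpace I x}, IsSmoothField I X → IsSmoothField I Y →
      d% (fun y => d% (fun y => inner ℝ (Z y) (W y)) y (Y y)) x (X x)
        = inner ℝ (covDeriv X (covDeriv Y Z) x) (W x) + inner ℝ (covDeriv Y Z x) (covDeriv X W x)
          + (inner ℝ (covDeriv X Z x) (covDeriv Y W x)
            + inner ℝ (Z x) (covDeriv X (covDeriv Y W) x)) := by
    intro X Y hX hY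
    simp only [mvfderiv_inner hY hZ hW]
    rw [mvfderiv_fun_add, add_apply, mvfderiv_inner hX (hY.covDeriv hZ) hW,
      mvfderiv_inner hX hZ (hY.covDeriv hW)]
    · exact ((hY.covDeriv hZ).inner hW).mdifferentiable (by simp) x
    · exact (hZ.inner (hY.covDeriv hW)).mdifferentiable (by simp) x
  rw [key hX hY, key hY hX] at h
  simp only [curvatureField_apply, inner_sub_left, inner_sub_right]
  linarith

lemma curvatureField_bianchi (hX : IsSmoothField I X) (hY : IsSmoothField I Y)
    (hZ : IsSmoothField I Z) (x : M) : curvatureField I X Y Z x + curvatureField I Y Z X x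
      + curvatureField I Z X Y x = 0 := by
  have key : ∀ {X Y Z : Π x : M, TangentSpace I x}, IsSmoothField I X → IsSmoothField I Y →
      IsSmoothField I Z → mlieBracket I X (mlieBracket I Y Z) x
      = covDeriv X (covDeriv Y Z) x - covDeriv X (covDeriv Z Y) x
        - covDeriv (mlieBracket I Y Z) X x := by
    intro X Y Z hX hY hZ
    rw [mlieBracket_eq_apply hX (hY.mlieBracket hZ), ← covDeriv_sub (hY.covDeriv hZ)
      (hZ.covDeriv hY), ← mlieBracket_eq hY hZ]
  have hj := jacobi_mlieBracket hX hY hZ x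
  rw [mlieBracket_swap_apply (V := mlieBracket I X Y)] at hj
  have h1 : covDeriv (mlieBracket I X Z) Y x = -covDeriv (mlieBracket I Z X) Y x := by
    rw [covDeriv_congr_left (Y := fun y => -mlieBracket I Z X y) x mlieBracket_swap_apply]
    simp only [covDeriv, map_neg]
  rw [key hX hY hZ, key hZ hX hY, key hY hX hZ, h1] at hj
  simp only [curvatureField_apply]
  rw [← sub_eq_zero] at hj
  rw [← hj]
  abel

lemma curvatureField_pair_symm (hX : IsSmoothField I X) (hY : IsSmoothField I Y)
    (hZ : IsSmoothField I Z) (hW : IsSmoothField I W) (x : M) :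
    (inner ℝ (curvatureField I X Y Z x) (W x) : ℝ) = inner ℝ (curvatureField I Z W X x) (Y x) :=
  pair_symm_of_bianchi (V := {X : Π x : M, TangentSpace I x // IsSmoothField I X})
    (R := fun X Y Z W => inner ℝ (curvatureField I X.1 Y.1 Z.1 x) (W.1 x))
    (fun X Y Z W => by rw [curvatureField_swap, inner_neg_left])
    (fun X Y Z W => by rw [curvatureField_skew X.2 Y.2 Z.2 W.2, real_inner_comm])
    (fun X Y Z W => by
      rw [← inner_add_left, ← inner_add_left, curvatureField_bianchi X.2 Y.2 Z.2, inner_zero_left])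
    ⟨X, hX⟩ ⟨Y, hY⟩ ⟨Z, hZ⟩ ⟨W, hW⟩

lemma inner_ext_fields {x : M} {v w : TangentSpace I x}
    (h : ∀ Z : Π x : M, TangentSpace I x, IsSmoothField I Z →
      (inner ℝ v (Z x) : ℝ) = inner ℝ w (Z x)) : v = w := by
  refine ext_inner_right ℝ fun z => ?_
  obtain ⟨Z, hZ, rfl, -⟩ := exists_isSmoothField I x z
  exact h Z hZ

lemma curvatureField_congr {X' Y' Z' : Π x : M, TangentSpace I x} (hX : IsSmoothField I X)
    (hY : IsSmoothField I Y) (hZ : IsSmoothField I Z) (hX' : IsSmoothField I X')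
    (hY' : IsSmoothField I Y') (hZ' : IsSmoothField I Z') {x : M} (h1 : X x = X' x)
    (h2 : Y x = Y' x) (h3 : Z x = Z' x) :
    curvatureField I X Y Z x = curvatureField I X' Y' Z' x := by
  have c3 : ∀ {X Y Z Z' : Π x : M, TangentSpace I x}, IsSmoothField I X → IsSmoothField I Y →
      IsSmoothField I Z → IsSmoothField I Z' → Z x = Z' x →
      curvatureField I X Y Z x = curvatureField I X Y Z' x := by
    intro X Y Z Z' hX hY hZ hZ' h
    refine inner_ext_fields fun W hW => ?_
    rw [curvatureField_skew hX hY hZ hW, curvatureField_skew hX hY hZ' hW, h]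
  have c1 : ∀ {X Y Z X' : Π x : M, TangentSpace I x}, IsSmoothField I X → IsSmoothField I Y →
      IsSmoothField I Z → IsSmoothField I X' → X x = X' x →
      curvatureField I X Y Z x = curvatureField I X' Y Z x := by
    intro X Y Z X' hX hY hZ hX' h
    refine inner_ext_fields fun W hW => ?_
    rw [curvatureField_pair_symm hX hY hZ hW, curvatureField_pair_symm hX' hY hZ hW,
      c3 hZ hW hX hX' h]
  rw [c1 hX hY hZ hX' h1, curvatureField_swap, c1 hY hX' hZ hY' h2, ← curvatureField_swap,
    c3 hX' hY' hZ hZ' h3]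

lemma leviCivita_congr_of_eventuallyEq (hY : IsSmoothField I Y) {x : M}
    (h : ∀ᶠ y in 𝓝 x, Z y = Y y) : leviCivita I M Z x = leviCivita I M Y x := by
  refine (leviCivita I M).isCovariantDerivativeOnUniv.congr_of_eventuallyEq ?_ (hY.mdiffAt x)
    univ_mem h
  refine (hY.mdiffAt x).congr_of_eventuallyEq ?_
  filter_upwards [h] with y hy
  rw [hy]

/-- The curvature tensor can be computed with arbitrary smooth fields. -/
theorem curvature_eq (hX : IsSmoothField I X) (hY : IsSmoothField I Y) (hZ : IsSmoothField I Z)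
    (x : M) : curvature I x (X x) (Y x) (Z x) = curvatureField I X Y Z x := by
  obtain ⟨X', hX', hXx, hXe⟩ := exists_isSmoothField I x (X x)
  obtain ⟨Y', hY', hYx, hYe⟩ := exists_isSmoothField I x (Y x)
  obtain ⟨Z', hZ', hZx, hZe⟩ := exists_isSmoothField I x (Z x)
  rw [curvatureField_congr hX hY hZ hX' hY' hZ' hXx.symm hYx.symm hZx.symm]
  have hc : ∀ {Y' : Π x : M, TangentSpace I x} {v : TangentSpace I x}, IsSmoothField I Y' →
      (∀ᶠ y in 𝓝 x, Y' y = extend E v y) →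
      leviCivita I M (fun y => leviCivita I M (extend E (Z x)) y (extend E v y)) x
        = leviCivita I M (covDeriv Y' Z') x := by
    intro Y' v hY' hYe
    refine leviCivita_congr_of_eventuallyEq (hY'.covDeriv hZ') ?_
    filter_upwards [hYe, hZe.eventually_nhds] with y h1 h2
    rw [covDeriv, h1, leviCivita_congr_of_eventuallyEq hZ' (h2.mono fun _ h => h.symm)]
  have hXe' : (extend E (X x) : Π y : M, TangentSpace I y) =ᶠ[𝓝 x] X' := hXe.mono fun _ h => h.symm
  have hYe' : (extend E (Y x) : Π y : M, TangentSpace I y) =ᶠ[𝓝 x] Y' := hYe.mono fun _ h => h.symm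
  rw [curvature, curvatureField, hc hY' hYe, hc hX' hXe,
    leviCivita_congr_of_eventuallyEq hZ' (hZe.mono fun _ h => h.symm),
    hXe'.mlieBracket_vectorField_eq hYe', hXe'.self_of_nhds, hYe'.self_of_nhds]
  rfl

lemma inner_curvature_skew (x : M) (u v w z : TangentSpace I x) :
    inner ℝ (curvature I x u v w) z = -(inner ℝ w (curvature I x u v z) : ℝ) := by
  obtain ⟨X, hX, rfl, -⟩ := exists_isSmoothField I x u
  obtain ⟨Y, hY, rfl, -⟩ := exists_isSmoothField I x v
  obtain ⟨Z, hZ, rfl, -⟩ := exists_isSmoothField I x w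
  obtain ⟨W, hW, rfl, -⟩ := exists_isSmoothField I x z
  rw [curvature_eq hX hY hZ, curvature_eq hX hY hW, curvatureField_skew hX hY hZ hW]

lemma inner_curvature_pair_symm (x : M) (u v w z : TangentSpace I x) :
    (inner ℝ (curvature I x u v w) z : ℝ) = inner ℝ (curvature I x w z u) v := by
  obtain ⟨X, hX, rfl, -⟩ := exists_isSmoothField I x u
  obtain ⟨Y, hY, rfl, -⟩ := exists_isSmoothField I x v
  obtain ⟨Z, hZ, rfl, -⟩ := exists_isSmoothField I x w
  obtain ⟨W, hW, rfl, -⟩ := exists_isSmoothField I x z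
  rw [curvature_eq hX hY hZ, curvature_eq hZ hW hX, curvatureField_pair_symm hX hY hZ hW]

lemma curvature_swap (x : M) (u v w : TangentSpace I x) :
    curvature I x u v w = -curvature I x v u w := curvatureField_swap x

lemma curvature_bianchi (x : M) (u v w : TangentSpace I x) :
    curvature I x u v w + curvature I x v w u + curvature I x w u v = 0 := by
  obtain ⟨X, hX, rfl, -⟩ := exists_isSmoothField I x u
  obtain ⟨Y, hY, rfl, -⟩ := exists_isSmoothField I x v
  obtain ⟨Z, hZ, rfl, -⟩ := exists_isSmoothField I x w
  rw [curvature_eq hX hY hZ, curvature_eq hY hZ hX, curvature_eq hZ hX hY,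
    curvatureField_bianchi hX hY hZ]

variable (I) in
/-- The curvature tensor at a point as a trilinear operator. -/
noncomputable def curvatureOperator (x : M) :
    TangentSpace I x →ₗ[ℝ] TangentSpace I x →ₗ[ℝ] TangentSpace I x →ₗ[ℝ] TangentSpace I x :=
  have add3 : ∀ u v w w', curvature I x u v (w + w') = curvature I x u v w + curvature I x u v w' :=
    fun u v w w' => ext_inner_right ℝ fun z => by
      simp only [inner_add_left, inner_curvature_skew x u v _ z]; ring
  have smul3 : ∀ u v (c : ℝ) w, curvature I x u v (c • w) = c • curvature I x u v w :=
    fun u v c w => ext_inner_right ℝ fun z => by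
      simp only [real_inner_smul_left, inner_curvature_skew x u v _ z]; ring
  have add1 : ∀ u u' v w, curvature I x (u + u') v w = curvature I x u v w + curvature I x u' v w :=
    fun u u' v w => ext_inner_right ℝ fun z => by
      simp only [inner_add_left, inner_curvature_pair_symm x _ v w z, add3]
  have smul1 : ∀ (c : ℝ) u v w, curvature I x (c • u) v w = c • curvature I x u v w :=
    fun c u v w => ext_inner_right ℝ fun z => by
      simp only [real_inner_smul_left, inner_curvature_pair_symm x _ v w z, smul3]
  LinearMap.mk₂ ℝ (fun u v => ⟨⟨curvature I x u v, add3 u v⟩, fun c w => smul3 u v c w⟩)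
    (fun u u' v => LinearMap.ext fun w => add1 u u' v w)
    (fun c u v => LinearMap.ext fun w => smul1 c u v w)
    (fun u v v' => LinearMap.ext fun w => by
      change curvature I x u (v + v') w = curvature I x u v w + curvature I x u v' w
      rw [curvature_swap, add1, neg_add, ← curvature_swap, ← curvature_swap])
    (fun c u v => LinearMap.ext fun w => by
      change curvature I x u (c • v) w = c • curvature I x u v w
      rw [curvature_swap, smul1, ← smul_neg, ← curvature_swap])

@[simp] lemma curvatureOperator_apply (x : M) (u v w : TangentSpace I x) :
    curvatureOperator I x u v w = curvature I x u v w := rfl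

lemma isCurvatureOperator_curvatureOperator (x : M) :
    IsCurvatureOperator (curvatureOperator I x) where
  swap := curvature_swap x
  skew := inner_curvature_skew x
  bianchi := curvature_bianchi x

end CurvatureSymmetries

/-! ### Derivatives of an almost complex structure -/

section AlmostHermitian

open Filter Topology

variable {E : Type*} [NormedAddCommGroup E] [NormedSpace ℝ E] [FiniteDimensional ℝ E]
  {H : Type*} [TopologicalSpace H] {I : ModelWithCorners ℝ E H}
  {M : Type*} [TopologicalSpace M] [ChartedSpace H M] [IsManifold I ∞ M]
  [RiemannianBundle (fun x : M => TangentSpace I x)]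
  [IsContMDiffRiemannianBundle I ∞ E (fun x : M => TangentSpace I x)]

variable {X Y Z W V : Π x : M, TangentSpace I x}

local notation "⟪" x "," y "⟫" => inner ℝ x y

namespace OrthogonalAlmostComplexStructure

variable (S : OrthogonalAlmostComplexStructure I M)

/-- `J` at a point, as a linear map. -/
noncomputable def linJ (x : M) : TangentSpace I x →ₗ[ℝ] TangentSpace I x := (S.J x).toLinearMap

@[simp] lemma linJ_apply (x : M) (v : TangentSpace I x) : S.linJ x v = S.J x v := rfl

lemma isOrthogonalComplex_linJ (x : M) : IsOrthogonalComplex (S.linJ x) :=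
  ⟨S.J_J x, S.inner_J_J x⟩

/-- `∇J` at a point, as a bilinear map. -/
noncomputable def linNablaJ (x : M) :
    TangentSpace I x →ₗ[ℝ] TangentSpace I x →ₗ[ℝ] TangentSpace I x :=
  LinearMap.mk₂ ℝ (fun v w => S.nablaJ x v w) (fun _ _ _ => by simp [nablaJ])
    (fun _ _ _ => by simp [nablaJ]) (fun _ _ _ => by simp) (fun _ _ _ => by simp)

@[simp] lemma linNablaJ_apply (x : M) (v w : TangentSpace I x) :
    S.linNablaJ x v w = S.nablaJ x v w := rfl

lemma isSmoothField_J (hY : IsSmoothField I Y) : IsSmoothField I (fun y => S.J y (Y y)) :=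
  ContMDiff.clm_bundle_apply (b := id) S.contMDiff_J hY

lemma covDeriv_J (X : Π x : M, TangentSpace I x) (hY : IsSmoothField I Y) (x : M) :
    covDeriv X (fun y => S.J y (Y y)) x
      = S.nablaJ x (X x) (Y x) + S.J x (covDeriv X Y x) := by
  rw [S.nablaJ_apply X (hY.mdiffAt x)]
  exact (sub_add_cancel _ _).symm

lemma nablaJ_fields (X : Π x : M, TangentSpace I x) (hY : IsSmoothField I Y) :
    (fun y => S.nablaJ y (X y) (Y y))
      = fun y => covDeriv X (fun y => S.J y (Y y)) y - S.J y (covDeriv X Y y) := by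
  funext y
  rw [S.covDeriv_J X hY, add_sub_cancel_right]

lemma inner_J (x : M) (v w : TangentSpace I x) : ⟪S.J x v, w⟫ = -⟪v, S.J x w⟫ :=
  (S.isOrthogonalComplex_linJ x).inner_left v w

lemma inner_J' (x : M) (v w : TangentSpace I x) : ⟪v, S.J x w⟫ = -⟪S.J x v, w⟫ := by
  rw [S.inner_J, neg_neg]

variable [T2Space M]

lemma isSmoothField_nablaJ (hX : IsSmoothField I X) (hY : IsSmoothField I Y) :
    IsSmoothField I (fun y => S.nablaJ y (X y) (Y y)) := by
  rw [S.nablaJ_fields X hY]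
  exact (hX.covDeriv (S.isSmoothField_J hY)).sub (S.isSmoothField_J (hX.covDeriv hY))

variable {S} in
/-- `∇J` is a complex cross product for a nearly Kähler structure. -/
lemma IsNearlyKahler.isComplexCrossProduct (hS : S.IsNearlyKahler) (x : M) :
    IsComplexCrossProduct (S.linJ x) (S.linNablaJ x) where
  self v := by
    obtain ⟨X, hX, rfl, -⟩ := exists_isSmoothField I x v
    exact hS X hX x
  skew u v w := by
    obtain ⟨X, hX, rfl, -⟩ := exists_isSmoothField I x u
    obtain ⟨Y, hY, rfl, -⟩ := exists_isSmoothField I x v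
    obtain ⟨Z, hZ, rfl, -⟩ := exists_isSmoothField I x w
    have h1 := mvfderiv_inner hX (S.isSmoothField_J hY) hZ x
    have h2 := mvfderiv_inner hX hY (S.isSmoothField_J hZ) x
    have h3 : (fun y => (⟪S.J y (Y y), Z y⟫ : ℝ)) = fun y => -⟪Y y, S.J y (Z y)⟫ :=
      funext fun y => S.inner_J y _ _
    rw [h3, mvfderiv_fun_neg, neg_apply, h2, S.covDeriv_J X hY, S.covDeriv_J X hZ, inner_add_left,
      inner_add_right, S.inner_J x (covDeriv X Y x), S.inner_J x (Y x)] at h1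
    simp only [linNablaJ_apply]
    linarith
  map_J u v := by
    obtain ⟨X, hX, rfl, -⟩ := exists_isSmoothField I x u
    obtain ⟨Y, hY, rfl, -⟩ := exists_isSmoothField I x v
    have h := S.covDeriv_J X (S.isSmoothField_J hY) x
    simp only [S.J_J] at h
    rw [covDeriv_neg hY, S.covDeriv_J X hY, map_add, S.J_J] at h
    simp only [linNablaJ_apply, linJ_apply]
    rw [eq_neg_iff_add_eq_zero]
    have h' := sub_eq_zero.2 h.symm
    rw [← h']
    abel

/-- The second derivative `(∇²_{W,X} J)Y` computed with fields. -/
noncomputable def nablaSqJField (W X Y : Π x : M, TangentSpace I x) (x : M) : TangentSpace I x :=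
  covDeriv W (fun y => S.nablaJ y (X y) (Y y)) x - S.nablaJ x (covDeriv W X x) (Y x)
    - S.nablaJ x (X x) (covDeriv W Y x)

lemma covDeriv_nablaJ (W X Y : Π x : M, TangentSpace I x) (x : M) :
    covDeriv W (fun y => S.nablaJ y (X y) (Y y)) x = S.nablaSqJField W X Y x
      + S.nablaJ x (covDeriv W X x) (Y x) + S.nablaJ x (X x) (covDeriv W Y x) := by
  rw [nablaSqJField]; abel

/-- The Ricci identity for `J`. -/
lemma nablaSqJField_sub_swap (hW : IsSmoothField I W) (hX : IsSmoothField I X)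
    (hY : IsSmoothField I Y) (x : M) :
    S.nablaSqJField W X Y x - S.nablaSqJField X W Y x
      = curvature I x (W x) (X x) (S.J x (Y x)) - S.J x (curvature I x (W x) (X x) (Y x)) := by
  have key : ∀ {W X : Π x : M, TangentSpace I x}, IsSmoothField I W → IsSmoothField I X →
      covDeriv W (fun y => S.nablaJ y (X y) (Y y)) x
        = covDeriv W (covDeriv X (fun y => S.J y (Y y))) x
          - (S.nablaJ x (W x) (covDeriv X Y x) + S.J x (covDeriv W (covDeriv X Y) x)) := by
    intro W X hW hX
    rw [S.nablaJ_fields X hY, covDeriv_sub (hX.covDeriv (S.isSmoothField_J hY))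
      (S.isSmoothField_J (hX.covDeriv hY)), S.covDeriv_J W (hX.covDeriv hY)]
  rw [curvature_eq hW hX hY, curvature_eq hW hX (S.isSmoothField_J hY), curvatureField_apply,
    curvatureField_apply, nablaSqJField, nablaSqJField, key hW hX, key hX hW,
    S.nablaJ_apply (covDeriv W X) (hY.mdiffAt x), S.nablaJ_apply (covDeriv X W) (hY.mdiffAt x)]
  simp only [covDeriv, mlieBracket_eq_apply hW hX, map_sub]
  abel

end OrthogonalAlmostComplexStructure

end AlmostHermitian

/-! ### Curvature of nearly Kähler structures in dimension six -/

section NearlyKahler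

open Filter Topology

variable {E : Type*} [NormedAddCommGroup E] [NormedSpace ℝ E] [FiniteDimensional ℝ E]
  {H : Type*} [TopologicalSpace H] {I : ModelWithCorners ℝ E H}
  {M : Type*} [TopologicalSpace M] [ChartedSpace H M] [IsManifold I ∞ M]
  [RiemannianBundle (fun x : M => TangentSpace I x)]
  [IsContMDiffRiemannianBundle I ∞ E (fun x : M => TangentSpace I x)]

variable {X Y Z W V X' Y' W' : Π x : M, TangentSpace I x}

local notation "⟪" x "," y "⟫" => inner ℝ x y

namespace OrthogonalAlmostComplexStructure

/-- All inner products of values of `∇J` at `x` are determined by the metric, `J` and `m`. -/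
abbrev IsTorsionScale (S : OrthogonalAlmostComplexStructure I M) (x : M) (m : ℝ) : Prop :=
  ∀ u v w z : TangentSpace I x, (⟪S.nablaJ x u v, S.nablaJ x w z⟫ : ℝ)
    = m * (⟪u, w⟫ * ⟪v, z⟫ - ⟪S.J x u, w⟫ * ⟪S.J x v, z⟫
      - ⟪u, z⟫ * ⟪v, w⟫ + ⟪S.J x u, z⟫ * ⟪S.J x v, w⟫)

variable [T2Space M] {S : OrthogonalAlmostComplexStructure I M}

namespace IsNearlyKahler

variable (hS : S.IsNearlyKahler)
include hS

lemma nablaJ_swap (x : M) (v w : TangentSpace I x) : S.nablaJ x v w = -S.nablaJ x w v :=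
  (hS.isComplexCrossProduct x).swap v w

lemma nablaJ_skew (x : M) (u v w : TangentSpace I x) :
    ⟪S.nablaJ x u v, w⟫ = -⟪v, S.nablaJ x u w⟫ :=
  (hS.isComplexCrossProduct x).skew u v w

lemma nablaJ_J (x : M) (u v : TangentSpace I x) :
    S.nablaJ x u (S.J x v) = -S.J x (S.nablaJ x u v) :=
  (hS.isComplexCrossProduct x).map_J u v

lemma nablaSqJField_swap (hX : IsSmoothField I X) (hY : IsSmoothField I Y) (x : M) :
    S.nablaSqJField W X Y x = -S.nablaSqJField W Y X x := by
  have h : (fun y => S.nablaJ y (X y) (Y y)) = fun y => -S.nablaJ y (Y y) (X y) :=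
    funext fun y => hS.nablaJ_swap y _ _
  rw [nablaSqJField, h, covDeriv_neg (S.isSmoothField_nablaJ hY hX), nablaSqJField,
    hS.nablaJ_swap x (covDeriv W X x), hS.nablaJ_swap x (X x)]
  abel

lemma inner_nablaSqJField (hW : IsSmoothField I W) (hX : IsSmoothField I X)
    (hY : IsSmoothField I Y) (hZ : IsSmoothField I Z) (x : M) :
    ⟪S.nablaSqJField W X Y x, Z x⟫ = -⟪Y x, S.nablaSqJField W X Z x⟫ := by
  have h1 := mvfderiv_inner hW (S.isSmoothField_nablaJ hX hY) hZ x
  have h2 := mvfderiv_inner hW hY (S.isSmoothField_nablaJ hX hZ) x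
  have h3 : (fun y => (⟪S.nablaJ y (X y) (Y y), Z y⟫ : ℝ)) = fun y => -⟪Y y, S.nablaJ y (X y) (Z y)⟫ :=
    funext fun y => hS.nablaJ_skew y _ _ _
  rw [h3, mvfderiv_fun_neg, neg_apply, h2] at h1
  simp only [nablaSqJField, inner_sub_left, inner_sub_right, hS.nablaJ_skew x _ (Y x),
    hS.nablaJ_skew x _ (covDeriv W Y x)]
  have h4 := hS.nablaJ_skew x (X x) (Y x) (covDeriv W Z x)
  linarith

lemma nablaSqJField_congr (hW : IsSmoothField I W) (hX : IsSmoothField I X)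
    (hY : IsSmoothField I Y) (hX' : IsSmoothField I X')
    (hY' : IsSmoothField I Y') {x : M} (h1 : W x = W' x) (h2 : X x = X' x) (h3 : Y x = Y' x) :
    S.nablaSqJField W X Y x = S.nablaSqJField W' X' Y' x := by
  have c3 : ∀ {W X Y Y' : Π x : M, TangentSpace I x}, IsSmoothField I W → IsSmoothField I X →
      IsSmoothField I Y → IsSmoothField I Y' → Y x = Y' x →
      S.nablaSqJField W X Y x = S.nablaSqJField W X Y' x := by
    intro W X Y Y' hW hX hY hY' h
    refine inner_ext_fields fun Z hZ => ?_
    rw [hS.inner_nablaSqJField hW hX hY hZ, hS.inner_nablaSqJField hW hX hY' hZ, h]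
  rw [c3 hW hX hY hY' h3, hS.nablaSqJField_swap hX hY', c3 hW hY' hX hX' h2,
    ← hS.nablaSqJField_swap hX' hY']
  simp only [nablaSqJField, covDeriv, h1]

/-- The derivative of the identity `(∇_X J)(JY) = -J(∇_X J)Y`. -/
lemma nablaSqJField_J (hX : IsSmoothField I X) (hY : IsSmoothField I Y) (x : M) :
    S.nablaSqJField W X (fun y => S.J y (Y y)) x = -S.J x (S.nablaSqJField W X Y x)
      - S.nablaJ x (X x) (S.nablaJ x (W x) (Y x)) - S.nablaJ x (W x) (S.nablaJ x (X x) (Y x)) := by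
  have h : (fun y => S.nablaJ y (X y) (S.J y (Y y))) = fun y => -S.J y (S.nablaJ y (X y) (Y y)) :=
    funext fun y => hS.nablaJ_J y _ _
  have hA := S.isSmoothField_nablaJ hX hY
  rw [nablaSqJField, h, covDeriv_neg (S.isSmoothField_J hA), S.covDeriv_J W hA, S.covDeriv_J W hY,
    hS.nablaJ_J, map_add, hS.nablaJ_J, nablaSqJField, map_sub, map_sub]
  abel

variable {x : M} {m : ℝ}

/-- In dimension six, `∇²J` is algebraic in `J`, and the curvature differs from that of a round
sphere by a tensor of Kähler type. -/
theorem nablaSqJField_eq (hdim : finrank ℝ E = 6)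
    (hP : S.IsTorsionScale x m) :
    (∀ {W X Y : Π x : M, TangentSpace I x}, IsSmoothField I W → IsSmoothField I X →
      IsSmoothField I Y → S.nablaSqJField W X Y x = -m • (⟪W x, X x⟫ • S.J x (Y x)
        - ⟪W x, Y x⟫ • S.J x (X x) + ⟪S.J x (X x), Y x⟫ • W x)) ∧
    ∀ u v w z : TangentSpace I x,
      ⟪(curvatureOperator I x - m • unitCurvature (TangentSpace I x)) u v (S.J x w), S.J x z⟫
        = ⟪(curvatureOperator I x - m • unitCurvature (TangentSpace I x)) u v w, z⟫ := by
  choose F hF hFx _ using exists_isSmoothField I x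
  let b : TangentSpace I x → TangentSpace I x → TangentSpace I x → TangentSpace I x :=
    fun w u v => S.nablaSqJField (F w) (F u) (F v) x
  let b₀ : TangentSpace I x → TangentSpace I x → TangentSpace I x → TangentSpace I x :=
    fun w u v => -m • (⟪w, u⟫ • S.J x v - ⟪w, v⟫ • S.J x u + ⟪S.J x u, v⟫ • w)
  have hb : ∀ {W X Y : Π x : M, TangentSpace I x}, IsSmoothField I W → IsSmoothField I X →
      IsSmoothField I Y → S.nablaSqJField W X Y x = b (W x) (X x) (Y x) := fun hW hX hY =>
    hS.nablaSqJField_congr hW hX hY (hF _) (hF _) (hFx _).symm (hFx _).symm (hFx _).symm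
  have hb23 : ∀ w u v, b w u v = -b w v u := fun w u v => hS.nablaSqJField_swap (hF _) (hF _) x
  have hb34 : ∀ w u v z, ⟪b w u v, z⟫ = -⟪b w u z, v⟫ := fun w u v z => by
    have := hS.inner_nablaSqJField (hF w) (hF u) (hF v) (hF z) x
    rw [hFx, hFx] at this
    rw [this, real_inner_comm]
  have hbJ : ∀ w u v, b w u (S.J x v) = -S.J x (b w u v)
      - S.nablaJ x u (S.nablaJ x w v) - S.nablaJ x w (S.nablaJ x u v) := fun w u v => by
    have := hS.nablaSqJField_J (W := F w) (hF u) (hF v) x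
    rw [hb (hF w) (hF u) (S.isSmoothField_J (hF v))] at this
    simpa only [hFx] using this
  have hbR : ∀ w u v, b w u v - b u w v
      = curvature I x w u (S.J x v) - S.J x (curvature I x w u v) := fun w u v => by
    have := S.nablaSqJField_sub_swap (hF w) (hF u) (hF v) x
    simpa only [hFx] using this
  have hJs : ∀ u v : TangentSpace I x, (⟪S.J x u, v⟫ : ℝ) = -⟪S.J x v, u⟫ := fun u v => by
    rw [S.inner_J, real_inner_comm]
  obtain ⟨hd, hK⟩ := ((isCurvatureOperator_curvatureOperator x).sub_smul
    (isCurvatureOperator_unitCurvature) m).kahler_of_alternation hdim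
    (S.isOrthogonalComplex_linJ x) (d := fun w u v z => ⟪b w u v - b₀ w u v, z⟫)
    (fun w u v z => by
      rw [hb23, ← inner_neg_left]
      congr 1
      simp only [b₀, hJs u v]
      module)
    (fun w u v z => by
      simp only [inner_sub_left, hb34 w u v z, b₀, real_inner_smul_left, inner_add_left]
      rw [hJs u v, hJs u z, hJs v z]
      ring)
    (fun w u v z => by
      simp only [linJ_apply, inner_sub_left, hbJ, b₀, real_inner_smul_left, inner_add_left,
        inner_neg_left, S.inner_J' x _ z, S.J_J, map_sub, map_add, map_smul, S.inner_J_J]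
      rw [hS.nablaJ_skew x u, hS.nablaJ_skew x w (S.nablaJ x u v), hP, hP]
      simp only [S.inner_J' x]
      rw [hJs v u, hJs w u, hJs w v, real_inner_comm w u, real_inner_comm w v, real_inner_comm v u]
      ring)
    (fun w u v z => by
      simp only [linJ_apply, inner_sub_left]
      have h := congrArg (fun t => (⟪t, z⟫ : ℝ)) (hbR w u v)
      simp only [inner_sub_left, S.inner_J x (curvature I x w u v)] at h
      simp only [LinearMap.sub_apply, LinearMap.smul_apply, curvatureOperator_apply,
        unitCurvature_apply, inner_sub_left, real_inner_smul_left, b₀, inner_add_left,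
        S.inner_J' x w z, S.inner_J' x u z, S.inner_J' x u v, S.inner_J' x w v]
      rw [real_inner_comm u w]
      linarith)
  refine ⟨fun {W X Y} hW hX hY => ?_, fun u v w z => by simpa using hK u v w z⟩
  rw [hb hW hX hY]
  refine ext_inner_right ℝ fun z => ?_
  have := hd (W x) (X x) (Y x) z
  rwa [inner_sub_left, sub_eq_zero] at this

end IsNearlyKahler

end OrthogonalAlmostComplexStructure

end NearlyKahler

section NearlyKahlerSix

open Filter Topology

variable {E : Type*} [NormedAddCommGroup E] [NormedSpace ℝ E] [FiniteDimensional ℝ E]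
  {H : Type*} [TopologicalSpace H] {I : ModelWithCorners ℝ E H}
  {M : Type*} [TopologicalSpace M] [ChartedSpace H M] [IsManifold I ∞ M]

/-- A function with vanishing differential on a connected manifold without boundary is constant. -/
lemma eq_of_mvfderiv_eq_zero [I.Boundaryless] [PreconnectedSpace M] {m : M → ℝ}
    (hd : ∀ x, MDiffAt m x) (h0 : ∀ x, d% m x = 0) (x y : M) : m x = m y := by
  refine IsLocallyConstant.apply_eq_of_preconnectedSpace
    ((IsLocallyConstant.iff_eventually_eq m).2 fun x => ?_) x y
  have htar : (extChartAt I x).target ∈ 𝓝 (extChartAt I x x) := extChartAt_target_mem_nhds x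
  obtain ⟨r, hr, hball⟩ := Metric.mem_nhds_iff.1 htar
  have hmd : ∀ z ∈ Metric.ball (extChartAt I x x) r,
      HasFDerivAt (m ∘ (extChartAt I x).symm) (0 : E →L[ℝ] ℝ) z := by
    intro z hz
    have h1 : MDifferentiableAt 𝓘(ℝ, E) I (extChartAt I x).symm z :=
      ((contMDiffOn_extChartAt_symm (n := 1) x).contMDiffAt
        (mem_of_superset (Metric.isOpen_ball.mem_nhds hz) hball)).mdifferentiableAt one_ne_zero
    have h2 := (hd ((extChartAt I x).symm z)).hasMFDerivAt.comp z h1.hasMFDerivAt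
    have h3 : mfderiv I 𝓘(ℝ) m ((extChartAt I x).symm z) = 0 := h0 _
    rw [h3, ContinuousLinearMap.zero_comp] at h2
    exact hasMFDerivAt_iff_hasFDerivAt.1 h2
  have hsrc : (extChartAt I x).source ∩ extChartAt I x ⁻¹' Metric.ball (extChartAt I x x) r
      ∈ 𝓝 x := inter_mem (extChartAt_source_mem_nhds x)
    ((continuousAt_extChartAt x).preimage_mem_nhds (Metric.ball_mem_nhds _ hr))
  filter_upwards [hsrc] with y hy
  have h := Metric.isOpen_ball.is_const_of_fderiv_eq_zero (𝕜 := ℝ)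
    (convex_ball (extChartAt I x x) r).isPreconnected
    (fun z hz => (hmd z hz).differentiableAt.differentiableWithinAt)
    (fun z hz => (hmd z hz).fderiv) hy.2 (Metric.mem_ball_self hr)
  have h1 : (extChartAt I x).symm (extChartAt I x y) = y := (extChartAt I x).left_inv hy.1
  simpa only [Function.comp, h1, extChartAt_to_inv] using h

variable [RiemannianBundle (fun x : M => TangentSpace I x)]
  [IsContMDiffRiemannianBundle I ∞ E (fun x : M => TangentSpace I x)]

variable {X Y Z W V : Π x : M, TangentSpace I x}

local notation "⟪" x "," y "⟫" => inner ℝ x y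

namespace OrthogonalAlmostComplexStructure

variable (S : OrthogonalAlmostComplexStructure I M)

lemma inner_J_self (x : M) (v : TangentSpace I x) : (⟪S.J x v, v⟫ : ℝ) = 0 := by
  rw [real_inner_comm]
  exact (S.isOrthogonalComplex_linJ x).inner_self v

/-- Two unit vectors spanning orthogonal complex lines. -/
lemma exists_unitary_pair (hdim : finrank ℝ E = 6) (x : M) : ∃ u v : TangentSpace I x,
    (⟪u, u⟫ : ℝ) = 1 ∧ (⟪v, v⟫ : ℝ) = 1 ∧ (⟪u, v⟫ : ℝ) = 0 ∧ (⟪S.J x u, v⟫ : ℝ) = 0 := by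
  have hfr : finrank ℝ (TangentSpace I x) = 6 := hdim
  obtain ⟨u, hu, -⟩ := exists_unit_orthogonal (V := TangentSpace I x) (ι := Fin 0) ![]
    (by simp [hfr])
  obtain ⟨v, hv, huv⟩ := exists_unit_orthogonal ![u, S.J x u] (by simp [hfr])
  exact ⟨u, v, hu, hv, huv 0, huv 1⟩

variable {S} in
lemma IsTorsionScale.inner_self_eq {x : M} {m : ℝ} (h : S.IsTorsionScale x m)
    (u v : TangentSpace I x) : (⟪S.nablaJ x u v, S.nablaJ x u v⟫ : ℝ)
      = m * (⟪u, u⟫ * ⟪v, v⟫ - ⟪u, v⟫ * ⟪u, v⟫ - ⟪S.J x u, v⟫ * ⟪S.J x u, v⟫) := by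
  rw [h, S.inner_J_self, real_inner_comm u v, S.inner_J x v u, real_inner_comm v,
    real_inner_comm (S.J x u) v]
  ring

variable {S}

lemma IsTorsionScale.unique (hdim : finrank ℝ E = 6) {x : M} {m m' : ℝ}
    (h : S.IsTorsionScale x m) (h' : S.IsTorsionScale x m') : m = m' := by
  obtain ⟨u, v, hu, hv, huv, hJuv⟩ := S.exists_unitary_pair hdim x
  have e := h.inner_self_eq u v
  rw [h'.inner_self_eq, hu, hv, huv, hJuv] at e
  linarith

variable [T2Space M]

namespace IsNearlyKahler

variable (hS : S.IsNearlyKahler)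
include hS

/-- The torsion scale of a nearly Kähler structure has vanishing differential. -/
theorem mvfderiv_torsionScale_eq_zero (hdim : finrank ℝ E = 6) {m : M → ℝ}
    (hm : ∀ x, S.IsTorsionScale x (m x)) (x : M) : MDiffAt m x ∧ d% m x = 0 := by
  obtain ⟨u, v, hu, hv, huv, hJuv⟩ := S.exists_unitary_pair hdim x
  obtain ⟨X, hX, rfl, -⟩ := exists_isSmoothField I x u
  obtain ⟨Y, hY, rfl, -⟩ := exists_isSmoothField I x v
  have hA := S.isSmoothField_nablaJ hX hY
  have hJX := S.isSmoothField_J hX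
  let N : M → ℝ := fun y => ⟪S.nablaJ y (X y) (Y y), S.nablaJ y (X y) (Y y)⟫
  let F : M → ℝ := fun y => ⟪X y, X y⟫ * ⟪Y y, Y y⟫ - ⟪X y, Y y⟫ * ⟪X y, Y y⟫
    - ⟪S.J y (X y), Y y⟫ * ⟪S.J y (X y), Y y⟫
  have hNF : N = fun y => m y * F y := funext fun y => (hm y).inner_self_eq _ _
  have sXX := (hX.inner hX)
  have sYY := (hY.inner hY)
  have sXY := (hX.inner hY)
  have sJ := (hJX.inner hY)
  have hF : ContMDiff I 𝓘(ℝ) ∞ F :=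
    ((sXX.mul sYY).sub (sXY.mul sXY)).sub (sJ.mul sJ)
  have hN : ContMDiff I 𝓘(ℝ) ∞ N := hA.inner hA
  have hFx : F x = 1 := by simp only [F, hu, hv, huv, hJuv]; norm_num
  have hne : ∀ᶠ y in 𝓝 x, F y ≠ 0 :=
    hF.continuous.continuousAt.eventually_ne (by rw [hFx]; exact one_ne_zero)
  have hmd : MDiffAt m x := by
    have h1 : MDiffAt (fun y => N y * (F y)⁻¹) x :=
      ContMDiffAt.mdifferentiableAt ((hN x).mul ((hF x).inv₀ hne.self_of_nhds)) (by simp)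
    refine h1.congr_of_eventuallyEq ?_
    filter_upwards [hne] with y hy
    rw [hNF]
    field_simp
  refine ⟨hmd, ?_⟩
  ext w
  obtain ⟨W, hW, rfl, -⟩ := exists_isSmoothField I x w
  have d1 : ∀ {f : M → ℝ}, ContMDiff I 𝓘(ℝ) ∞ f → MDiffAt f x := fun hf =>
    hf.mdifferentiable (by simp) x
  have hdN := mvfderiv_inner hW hA hA x
  change d% N x (W x) = _ at hdN
  have hdF : d% F x (W x) = 2 * ⟪covDeriv W X x, X x⟫ + 2 * ⟪covDeriv W Y x, Y x⟫ := by
    have m1 : MDiffAt (fun y => (⟪X y, X y⟫ * ⟪Y y, Y y⟫ : ℝ)) x := d1 (sXX.mul sYY)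
    have m2 : MDiffAt (fun y => (⟪X y, Y y⟫ * ⟪X y, Y y⟫ : ℝ)) x := d1 (sXY.mul sXY)
    have m3 : MDiffAt (fun y => (⟪S.J y (X y), Y y⟫ * ⟪S.J y (X y), Y y⟫ : ℝ)) x :=
      d1 (sJ.mul sJ)
    have m4 : MDiffAt (fun y => (⟪X y, X y⟫ * ⟪Y y, Y y⟫ - ⟪X y, Y y⟫ * ⟪X y, Y y⟫ : ℝ)) x :=
      d1 ((sXX.mul sYY).sub (sXY.mul sXY))
    simp only [F]
    rw [mvfderiv_fun_sub m4 m3, mvfderiv_fun_sub m1 m2, mvfderiv_fun_mul (d1 sXX) (d1 sYY),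
      mvfderiv_fun_mul (d1 sXY) (d1 sXY), mvfderiv_fun_mul (d1 sJ) (d1 sJ)]
    simp only [sub_apply, add_apply, smul_apply, smul_eq_mul, hu, hv, huv, hJuv,
      mvfderiv_inner hW hX hX, mvfderiv_inner hW hY hY, real_inner_comm (covDeriv W X x),
      real_inner_comm (covDeriv W Y x)]
    ring
  have hB := (hS.nablaSqJField_eq hdim (hm x)).1 hW hX hY
  have hm1 := hm x (covDeriv W X x) (Y x) (X x) (Y x)
  have hm2 := hm x (X x) (covDeriv W Y x) (X x) (Y x)
  rw [hNF, mvfderiv_fun_mul hmd (d1 hF)] at hdN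
  simp only [add_apply, smul_apply, smul_eq_mul, hFx, hdF, S.covDeriv_nablaJ, hB] at hdN
  have hself : ∀ v, S.nablaJ x v v = 0 := (hS.isComplexCrossProduct x).self
  have o1 : (⟪S.J x (X x), S.nablaJ x (X x) (Y x)⟫ : ℝ) = 0 := by
    rw [real_inner_comm, hS.nablaJ_skew, hS.nablaJ_J, hself]
    simp
  have o2 : (⟪S.J x (Y x), S.nablaJ x (X x) (Y x)⟫ : ℝ) = 0 := by
    rw [real_inner_comm, hS.nablaJ_swap, inner_neg_left, hS.nablaJ_skew, hS.nablaJ_J, hself]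
    simp
  rw [real_inner_comm (_ + _) (S.nablaJ x (X x) (Y x))] at hdN
  simp only [inner_add_left, inner_sub_left, real_inner_smul_left, hm1, hm2, hu, hv, huv, hJuv,
    o1, o2, S.inner_J_self] at hdN
  rw [real_inner_comm (X x) (Y x), huv, S.inner_J x (Y x), real_inner_comm _ (Y x), hJuv] at hdN
  simp only [zero_apply]
  linarith

/-- The curvature operators, reduced by those of a round sphere, are derivations of `∇J`. -/
theorem curvature_derivation (hdim : finrank ℝ E = 6) {c : ℝ} (hc : ∀ x, S.IsTorsionScale x c)
    {x : M} (u v w z : TangentSpace I x) :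
    (curvatureOperator I x - c • unitCurvature (TangentSpace I x)) u v (S.nablaJ x w z)
      = S.nablaJ x ((curvatureOperator I x - c • unitCurvature (TangentSpace I x)) u v w) z
        + S.nablaJ x w ((curvatureOperator I x - c • unitCurvature (TangentSpace I x)) u v z) := by
  obtain ⟨V, hV, rfl, -⟩ := exists_isSmoothField I x u
  obtain ⟨W, hW, rfl, -⟩ := exists_isSmoothField I x v
  obtain ⟨X, hX, rfl, -⟩ := exists_isSmoothField I x w
  obtain ⟨Y, hY, rfl, -⟩ := exists_isSmoothField I x z
  have hA := S.isSmoothField_nablaJ hX hY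
  have hJX := S.isSmoothField_J hX
  have hJY := S.isSmoothField_J hY
  have hB : ∀ {W X Y : Π x : M, TangentSpace I x}, IsSmoothField I W → IsSmoothField I X →
      IsSmoothField I Y → ∀ x, covDeriv W (fun y => S.nablaJ y (X y) (Y y)) x
        = -c • (⟪W x, X x⟫ • S.J x (Y x) - ⟪W x, Y x⟫ • S.J x (X x) + ⟪S.J x (X x), Y x⟫ • W x)
          + S.nablaJ x (covDeriv W X x) (Y x) + S.nablaJ x (X x) (covDeriv W Y x) := by
    intro W X Y hW hX hY x
    rw [S.covDeriv_nablaJ, (hS.nablaSqJField_eq hdim (hc x)).1 hW hX hY]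
  have key : ∀ {V W : Π x : M, TangentSpace I x}, IsSmoothField I V → IsSmoothField I W →
      covDeriv V (covDeriv W (fun y => S.nablaJ y (X y) (Y y))) x
      = -c • (((⟪covDeriv V W x, X x⟫ + ⟪W x, covDeriv V X x⟫) • S.J x (Y x)
            + ⟪W x, X x⟫ • (S.nablaJ x (V x) (Y x) + S.J x (covDeriv V Y x)))
          - ((⟪covDeriv V W x, Y x⟫ + ⟪W x, covDeriv V Y x⟫) • S.J x (X x)
            + ⟪W x, Y x⟫ • (S.nablaJ x (V x) (X x) + S.J x (covDeriv V X x)))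
          + ((⟪S.nablaJ x (V x) (X x) + S.J x (covDeriv V X x), Y x⟫
              + ⟪S.J x (X x), covDeriv V Y x⟫) • W x
            + ⟪S.J x (X x), Y x⟫ • covDeriv V W x))
        + covDeriv V (fun y => S.nablaJ y (covDeriv W X y) (Y y)) x
        + covDeriv V (fun y => S.nablaJ y (X y) (covDeriv W Y y)) x := by
    intro V W hV hW
    have e1 := IsSmoothField.smul (hW.inner hX) hJY
    have e2 := IsSmoothField.smul (hW.inner hY) hJX
    have e3 := IsSmoothField.smul (hJX.inner hY) hW
    have e4 := S.isSmoothField_nablaJ (hW.covDeriv hX) hY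
    have e5 := S.isSmoothField_nablaJ hX (hW.covDeriv hY)
    rw [show covDeriv W (fun y => S.nablaJ y (X y) (Y y)) = _ from funext (hB hW hX hY),
      covDeriv_add (((e1.sub e2).add e3).const_smul (-c) |>.add e4) e5,
      covDeriv_add (((e1.sub e2).add e3).const_smul (-c)) e4,
      covDeriv_const_smul (-c) ((e1.sub e2).add e3), covDeriv_add (e1.sub e2) e3,
      covDeriv_sub e1 e2, covDeriv_smul (hW.inner hX) hJY, covDeriv_smul (hW.inner hY) hJX,
      covDeriv_smul (hJX.inner hY) hW, mvfderiv_inner hV hW hX, mvfderiv_inner hV hW hY,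
      mvfderiv_inner hV hJX hY, S.covDeriv_J V hX, S.covDeriv_J V hY]
  have hbr : ∀ Z : Π x : M, TangentSpace I x, covDeriv (mlieBracket I V W) Z x
      = covDeriv (fun y => covDeriv V W y - covDeriv W V y) Z x := fun Z => by
    rw [mlieBracket_eq hV hW]
  have hVW := (hV.covDeriv hW).sub (hW.covDeriv hV)
  simp only [LinearMap.sub_apply, LinearMap.smul_apply, curvatureOperator_apply,
    unitCurvature_apply]
  rw [curvature_eq hV hW hX, curvature_eq hV hW hY, curvature_eq hV hW hA, curvatureField_apply,
    curvatureField_apply, curvatureField_apply, key hV hW, key hW hV, hB hV (hW.covDeriv hX) hY,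
    hB hV hX (hW.covDeriv hY), hB hW (hV.covDeriv hX) hY, hB hW hX (hV.covDeriv hY), hbr, hbr, hbr,
    hB hVW hX hY]
  have hadd : ∀ u v w, S.nablaJ x (u + v) w = S.nablaJ x u w + S.nablaJ x v w := fun u v w => by
    simp [nablaJ]
  have hneg : ∀ u w, S.nablaJ x (-u) w = -S.nablaJ x u w := fun u w => by simp [nablaJ]
  have hsmul : ∀ (r : ℝ) u w, S.nablaJ x (r • u) w = r • S.nablaJ x u w := fun r u w => by
    simp [nablaJ]
  have hd : ∀ Z : Π x : M, TangentSpace I x,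
      covDeriv (fun y => covDeriv V W y - covDeriv W V y) Z x
        = covDeriv (covDeriv V W) Z x - covDeriv (covDeriv W V) Z x := fun Z => by
    simp only [covDeriv, map_sub]
  have hcyc : ∀ w, (⟪w, S.nablaJ x (X x) (Y x)⟫ : ℝ) = ⟪S.nablaJ x w (X x), Y x⟫ := fun w => by
    rw [real_inner_comm]
    exact (hS.isComplexCrossProduct x).cycle _ _ _
  simp only [hd, hcyc]
  simp only [hS.nablaJ_swap x (X x) (V x), hS.nablaJ_swap x (X x) (W x), sub_eq_add_neg, hadd, hneg, hsmul, map_add, map_neg, map_smul, inner_add_left,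
    inner_neg_left, smul_add, smul_neg, neg_smul, neg_neg]
  module

end IsNearlyKahler

end OrthogonalAlmostComplexStructure

end NearlyKahlerSix

section StrictNearlyKahlerSix

variable {E : Type*} [NormedAddCommGroup E] [NormedSpace ℝ E] [FiniteDimensional ℝ E]
  {H : Type*} [TopologicalSpace H] {I : ModelWithCorners ℝ E H}
  {M : Type*} [TopologicalSpace M] [ChartedSpace H M] [IsManifold I ∞ M]
  [RiemannianBundle (fun x : M => TangentSpace I x)]
  [IsContMDiffRiemannianBundle I ∞ E (fun x : M => TangentSpace I x)] [T2Space M]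

local notation "⟪" x "," y "⟫" => inner ℝ x y

/-- The Ricci tensor computed in an arbitrary orthonormal basis. -/
lemma ricci_eq_sum {ι : Type*} [Fintype ι] {x : M} (b : OrthonormalBasis ι ℝ (TangentSpace I x))
    (u v : TangentSpace I x) :
    ricci I x u v = ∑ k, ⟪curvatureOperator I x u (b k) (b k), v⟫ :=
  (stdOrthonormalBasis ℝ (TangentSpace I x)).sum_bilin_eq b
    (LinearMap.compr₂ (curvatureOperator I x u) (innerₗ (TangentSpace I x) |>.flip v))

namespace OrthogonalAlmostComplexStructure

variable {S : OrthogonalAlmostComplexStructure I M}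

lemma hasConstantType_iff (hdim : finrank ℝ E = 6) {c : ℝ} (hc : ∀ x, S.IsTorsionScale x c)
    [Nonempty M] {μ : ℝ} : S.HasConstantType μ ↔ μ ^ 2 = c := by
  have key : ∀ (x : M) (v w : TangentSpace I x), ‖S.nablaJ x v w‖ ^ 2
      = c * (‖v‖ ^ 2 * ‖w‖ ^ 2 - (inner ℝ v w : ℝ) ^ 2 - S.sigma x v w ^ 2) := fun x v w => by
    simp only [← real_inner_self_eq_norm_sq, (hc x).inner_self_eq, sigma]
    ring
  refine ⟨fun h => ?_, fun h => by subst h; exact key⟩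
  obtain ⟨x⟩ := ‹Nonempty M›
  obtain ⟨u, v, hu, hv, huv, hJuv⟩ := S.exists_unitary_pair hdim x
  have e := h x u v
  rw [key] at e
  simp only [sigma, ← real_inner_self_eq_norm_sq, hu, hv, huv, hJuv] at e
  linarith

namespace IsNearlyKahler

variable (hS : S.IsNearlyKahler)
include hS

/-- The torsion of a nearly Kähler structure on a connected six-manifold is of constant scale. -/
theorem exists_isTorsionScale [I.Boundaryless] [ConnectedSpace M] (hdim : finrank ℝ E = 6) :
    ∃ c : ℝ, 0 ≤ c ∧ ∀ x, S.IsTorsionScale x c := by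
  choose b a c hb h01 h12 h20 hP using fun x : M => (hS.isComplexCrossProduct x).exists_inner_eq
    (show finrank ℝ (TangentSpace I x) = 6 from hdim) (S.isOrthogonalComplex_linJ x)
  let m : M → ℝ := fun x => a x ^ 2 + c x ^ 2
  have hm : ∀ x, S.IsTorsionScale x (m x) := hP
  have hd := hS.mvfderiv_torsionScale_eq_zero hdim hm
  obtain ⟨x₀⟩ := (inferInstance : Nonempty M)
  refine ⟨m x₀, by positivity, fun x => ?_⟩
  rw [← eq_of_mvfderiv_eq_zero (fun x => (hd x).1) (fun x => (hd x).2) x x₀]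
  exact hm x

/-- The Ricci tensor of a nearly Kähler structure of constant non-zero torsion scale. -/
theorem ricci_eq (hdim : finrank ℝ E = 6) {c : ℝ} (hc : ∀ x, S.IsTorsionScale x c) (hc0 : c ≠ 0)
    (x : M) (u v : TangentSpace I x) : ricci I x u v = 5 * c * ⟪u, v⟫ := by
  have hfr : finrank ℝ (TangentSpace I x) = 6 := hdim
  have hA := hS.isComplexCrossProduct x
  obtain ⟨b, a, e, hb, h01, h12, h20, hP⟩ := hA.exists_inner_eq hfr (S.isOrthogonalComplex_linJ x)
  have hae : a ^ 2 + e ^ 2 = c := IsTorsionScale.unique (S := S) hdim hP (hc x)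
  have hR := (isCurvatureOperator_curvatureOperator x).sub_smul
    (isCurvatureOperator_unitCurvature (V := TangentSpace I x)) c
  have h0 := hR.ricci_eq_zero_of_kahler (S.isOrthogonalComplex_linJ x)
    (hS.nablaSqJField_eq hdim (hc x)).2 b hb (fun u v => hA.trace_derivation_eq_zero
      (S.isOrthogonalComplex_linJ x) b hb (hae ▸ hc0) h01 h12 h20 (hR.skew u v)
      (hS.curvature_derivation hdim hc u v)) u v
  have h1 : ∑ k, (⟪unitCurvature (TangentSpace I x) u (b k) (b k), v⟫ : ℝ) = 5 * ⟪u, v⟫ := by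
    have hb1 : ∀ k, (⟪b k, b k⟫ : ℝ) = 1 := fun k => by
      rw [real_inner_self_eq_norm_sq, b.norm_eq_one, one_pow]
    have := b.sum_inner_mul_inner u v
    simp only [unitCurvature_apply, inner_sub_left, real_inner_smul_left, hb1, one_mul,
      Finset.sum_sub_distrib, this]
    simp
    ring
  simp only [LinearMap.sub_apply, LinearMap.smul_apply, inner_sub_left, real_inner_smul_left,
    Finset.sum_sub_distrib, ← Finset.mul_sum, h1] at h0
  rw [ricci_eq_sum b]
  linarith

end IsNearlyKahler

end OrthogonalAlmostComplexStructure

end StrictNearlyKahlerSix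

theorem mainTheorem1
    {M : Type*} [TopologicalSpace M] [T2Space M] [SecondCountableTopology M] [ConnectedSpace M]
    [ChartedSpace (EuclideanSpace ℝ (Fin 6)) M] [IsManifold (𝓡 6) ∞ M]
    [RiemannianBundle (fun x : M => TangentSpace (𝓡 6) x)]
    [IsContMDiffRiemannianBundle (𝓡 6) ∞ (EuclideanSpace ℝ (Fin 6))
      (fun x : M => TangentSpace (𝓡 6) x)]
    (S : OrthogonalAlmostComplexStructure (𝓡 6) M)
    (hNK : S.IsNearlyKahler) (hstrict : S.IsStrict) :
    (IsEinstein (𝓡 6) M ∧ ∀ x : M, 0 < scalarCurvature (𝓡 6) x) ∧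
    (∃! μ : ℝ, 0 < μ ∧ S.HasConstantType μ) ∧
    (∀ μ : ℝ, 0 < μ → S.HasConstantType μ →
      ∀ (x : M) (u v : TangentSpace (𝓡 6) x), ricci (𝓡 6) x u v = 5 * μ ^ 2 * inner ℝ u v) := by
  have hdim : finrank ℝ (EuclideanSpace ℝ (Fin 6)) = 6 := by simp
  obtain ⟨c, hc0, hc⟩ := hNK.exists_isTorsionScale hdim
  have hpos : 0 < c := by
    refine lt_of_le_of_ne hc0 fun h => ?_
    obtain ⟨x, v, w, hne⟩ := hstrict
    apply hne
    rw [← inner_self_eq_zero (𝕜 := ℝ), (hc x).inner_self_eq, ← h, zero_mul]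
  have hric := hNK.ricci_eq hdim hc hpos.ne'
  have htype : ∀ {μ : ℝ}, S.HasConstantType μ ↔ μ ^ 2 = c :=
    OrthogonalAlmostComplexStructure.hasConstantType_iff hdim hc
  refine ⟨⟨⟨5 * c, hric⟩, fun x => ?_⟩, ⟨√c, ⟨Real.sqrt_pos.2 hpos, htype.2 (Real.sq_sqrt hc0)⟩,
    fun μ hμ => ?_⟩, fun μ hμ h x u v => ?_⟩
  · have hfr : finrank ℝ (TangentSpace (𝓡 6) x) = 6 := hdim
    simp only [scalarCurvature, hric, real_inner_self_eq_norm_sq, OrthonormalBasis.norm_eq_one]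
    simp only [one_pow, mul_one, Finset.sum_const, Finset.card_univ, Fintype.card_fin, hfr]
    positivity
  · rw [← htype.1 hμ.2, Real.sqrt_sq hμ.1.le]
  · rw [htype.1 h, hric]
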